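/- **Setting.** Let $\mathcal S=\{1,\dots,D\}$ and let $\Pi=(\pi_{ij})_{i,j\in\mathcal S}$ be an irreducible generator ($\pi_{ij}\ge 0$ for $i\ne j$, $\pi_{ii}=-\sum_{j\neq i}\pi_{ij}$). Let $\alpha=(\alpha_t)_{t\ge0}$ be an $\mathcal S$-valued process with right-continuous paths having left limits and, for each $i\in\mathcal S$, let $\mathbb P_i$ be a probability measure under which $\alpha$ is a Markov chain with generator $\Pi$ and $\alpha_0=i$. Let $\mathbb E_i$ be the expectation under $\mathbb P_i$ and $\mathbb F^i$ the natural filtration of $\alpha$ augmented by the $\mathbb P_i$-null sets. Write $L^2_{\mathbb F}(\mathbb R^k)$ (resp. $L^2_{\mathcal P}(\mathbb R^k)$) for the set of $\mathbb R^k$-valued $\mathbb F^i$-progressively measurable (resp. $\mathbb F^i$-predictable) processes $\varphi$ with $\mathbb E_i\int_0^\infty|\varphi(t)|^2dt<\infty$, processes that agree $dt\otimes d\mathbb P_i$-a.e. being identified; a process not tied to an initial state is said to be in one of these spaces if it is so for every $i\in\mathcal S$. For $i\in\mathcal S$ let $A(i)\in\mathbb R^{n\times n}$, $B(i)\in\mathbb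 R^{n\times m}$, $S(i)\in\mathbb R^{m\times n}$, $Q(i)\in\mathbb R^{n\times n}$ symmetric, $R(i)\in\mathbb R^{m\times m}$ symmetric positive definite with $Q(i)-S(i)^\top R(i)^{-1}S(i)\ge0$; let $b,q\in L^2_{\mathbb F}(\mathbb R^n)$, $\rho\in L^2_{\mathbb F}(\mathbb R^m)$. For $(x,i)\in\mathbb R^n\times\mathcal S$ and $u\in L^2_{\mathcal P}(\mathbb R^m)$, let $X=X(\cdot;x,i,u)$ be the solution of $$\dot X(t)=A(\alpha_t)X(t)+B(\alpha_t)u(t)+b(t),\qquad X(0)=x,\ \alpha_0=i,$$ put $\mathcal U_{LQ}(x,i)=\{u\in L^2_{\mathcal P}(\mathbb R^m): X(\cdot;x,i,u)\in L^2_{\mathbb F}(\mathbb R^n)\}$ and $$J(x,i;u)=\mathbb E_i\int_0^\infty\Big[\Big\langle\begin{pmatrix}Q(\alpha_t)&S(\alpha_t)^\top\\S(\alpha_t)&R(\alpha_t)\end{pmatrix}\begin{pmatrix}X\\u\end{pmatrix},\begin{pmatrix}X\\u\end{pmatrix}\Big\rangle+2\Big\langle\begin{pmatrix}q\\\rho\end{pmatrix},\begin{pmatrix}X\\u\end{pmatrix}\Big\rangle\Big]dt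 .$$ A family $\Theta=(\Theta(i))_{i\in\mathcal S}$ of matrices in $\mathbb R^{m\times n}$ is a *stabilizer*, $\Theta\in\mathcal H_\alpha$, if there are symmetric positive definite $P(i)$, $i\in\mathcal S$, such that $P(i)[A(i)+B(i)\Theta(i)]+[A(i)+B(i)\Theta(i)]^\top P(i)+\sum_j\pi_{ij}P(j)<0$ for all $i$. For $\Theta\in\mathcal H_\alpha$ let $X_\Theta(\cdot;x,i,\nu)$ and $J_\Theta(x,i;\nu)$ be the state and the cost obtained from those above when $A,Q,S,q$ are replaced by $A_\Theta=A+B\Theta$, $Q_\Theta=Q+S^\top\Theta+\Theta^\top S+\Theta^\top R\Theta$, $S_\Theta=S+R\Theta$, $q_\Theta=q+\Theta(\alpha)^\top\rho$, and $u$ by $\nu$. A control $\nu^*\in L^2_{\mathcal P}(\mathbb R^m)$ is an *open-loop optimal control of Problem (M-LQ)$_\Theta$ for $(x,i)$* if $J_\Theta(x,i;\nu^*)=\inf_{\nu\in L^2_{\mathcal P}(\mathbb R^m)}J_\Theta(x,i;\nu)$. A pair $(\widehat\Theta,\widehat\nu)\in\mathcal H_\alpha\times L^2_{\mathcal P}(\mathbb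 R^m)$ is a *closed-loop optimal control of Problem (M-LQ)* if $J(x,i;\widehat\Theta(\alpha)X_{\widehat\Theta}(\cdot;x,i,\widehat\nu)+\widehat\nu)\le J(x,i;u)$ for all $(x,i)\in\mathbb R^n\times\mathcal S$ and all $u\in\mathcal U_{LQ}(x,i)$. **Proposition.** Assume $\mathcal H_\alpha\neq\emptyset$, and let $(\widehat\Theta,\widehat\nu)\in\mathcal H_\alpha\times L^2_{\mathcal P}(\mathbb R^m)$. Then $(\widehat\Theta,\widehat\nu)$ is a closed-loop optimal control of Problem (M-LQ) if and only if $\widehat\nu$ is an open-loop optimal control of Problem (M-LQ)$_{\widehat\Theta}$ for every initial value $(x,i)\in\mathbb R^n\times\mathcal S$. Moreover, for every $(x,i)$, $J_{\widehat\Theta}(x,i;\nu)=J(x,i;\widehat\Theta(\alpha)X_{\widehat\Theta}(\cdot;x,i,\nu)+\nu)$ for all $\nu\in L^2_{\mathcal P}(\mathbb R^m)$, and $$\mathcal U_{LQ}(x,i)=\big\{\widehat\Theta(\alpha)X_{\widehat\Theta}(\cdot;x,i,\nu)+\nu:\ \nu\in L^2_{\mathcal P}(\mathbb R^m)\big\}.$$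 -/

import Mathlib

open MeasureTheory ProbabilityTheory Filter Topology
open scoped NNReal ENNReal Matrix

namespace MarkovLQ

noncomputable section

/-- Lebesgue measure `dt` on the time axis `[0, ∞)`. -/
def timeMeasure : Measure ℝ≥0 := (volume : Measure ℝ).comap ((↑) : ℝ≥0 → ℝ)

/-! ### The Markov chain and its filtration -/

section Chain

variable {D : ℕ} {Ω : Type*} [mΩ : MeasurableSpace Ω]

/-- `G` is an irreducible generator on the finite state space `Fin D`: nonnegative off-diagonal
rates, zero row sums, and any state can be reached from any other through positive rates. -/
structure IsIrreducibleGenerator (G : Matrix (Fin D) (Fin D) ℝ) : Prop where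
  nonneg : ∀ i j, i ≠ j → 0 ≤ G i j
  diag : ∀ i, G i i = -∑ j ∈ Finset.univ.erase i, G i j
  irreducible : ∀ i j, Relation.ReflTransGen (fun k l => k ≠ l ∧ 0 < G k l) i j

/-- The σ-algebra generated by the `μ`-null sets. -/
abbrev nullSigma (μ : Measure Ω) : MeasurableSpace Ω :=
  MeasurableSpace.generateFrom {N | MeasurableSet N ∧ μ N = 0}

lemma nullSigma_le (μ : Measure Ω) : nullSigma μ ≤ mΩ :=
  MeasurableSpace.generateFrom_le fun _ hN => hN.1

/-- The natural filtration of `α`, augmented by all `μ`-null sets. -/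
def augFiltration (α : ℝ≥0 → Ω → Fin D) (hα : ∀ t, Measurable (α t)) (μ : Measure Ω) :
    Filtration ℝ≥0 mΩ :=
  Filtration.natural α (fun t => (hα t).stronglyMeasurable) ⊔
    Filtration.const ℝ≥0 (nullSigma μ) (nullSigma_le μ)

/-- Under `μ`, the process `α` is a continuous-time Markov chain with generator `G` and initial
state `i`, i.e. `μ(α_t = j | 𝓕_s) = (e^{(t-s)G})_{α_s, j}` for `s ≤ t`; its paths are right
continuous with left limits in the discrete space `Fin D`. -/
structure IsMarkovChainFrom (G : Matrix (Fin D) (Fin D) ℝ) (α : ℝ≥0 → Ω → Fin D)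
    (hα : ∀ t, Measurable (α t)) (μ : Measure Ω) (i : Fin D) : Prop where
  right_cont : ∀ ω t, ContinuousWithinAt (fun s => α s ω) (Set.Ici t) t
  left_lim : ∀ ω t, ∃ j, Tendsto (fun s => α s ω) (𝓝[<] t) (𝓝 j)
  init : ∀ᵐ ω ∂μ, α 0 ω = i
  markov : ∀ s t : ℝ≥0, s ≤ t → ∀ j : Fin D,
    μ[Set.indicator {ω | α t ω = j} (fun _ => (1 : ℝ)) | augFiltration α hα μ s] =ᵐ[μ]
      fun ω => NormedSpace.exp (((t : ℝ) - (s : ℝ)) • G) (α s ω) j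

end Chain

/-! ### Spaces of square-integrable processes

Processes are identified when they agree `dt ⊗ dμ`-almost everywhere; being progressively
measurable or predictable means having a version with this property. Square integrability does
not depend on the norm chosen on `Fin k → ℝ`. -/

section Processes

variable {Ω : Type*} [mΩ : MeasurableSpace Ω] {k : ℕ}

/-- `L²_𝔽(ℝᵏ)`: progressively measurable processes with `E ∫₀^∞ |φ(t)|² dt < ∞`. -/
def L2F (𝔽 : Filtration ℝ≥0 mΩ) (μ : Measure Ω) : Set (ℝ≥0 → Ω → Fin k → ℝ) :=
  {φ | MemLp (Function.uncurry φ) 2 (timeMeasure.prod μ) ∧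
    ∃ ψ, IsStronglyProgressive 𝔽 ψ ∧
      Function.uncurry φ =ᵐ[timeMeasure.prod μ] Function.uncurry ψ}

/-- `L²_𝒫(ℝᵏ)`: predictable processes with `E ∫₀^∞ |φ(t)|² dt < ∞`. -/
def L2P (𝔽 : Filtration ℝ≥0 mΩ) (μ : Measure Ω) : Set (ℝ≥0 → Ω → Fin k → ℝ) :=
  {φ | MemLp (Function.uncurry φ) 2 (timeMeasure.prod μ) ∧
    ∃ ψ, IsStronglyPredictable 𝔽 ψ ∧
      Function.uncurry φ =ᵐ[timeMeasure.prod μ] Function.uncurry ψ}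

end Processes

/-! ### The linear-quadratic problem -/

/-- Coefficients of the controlled state equation `Ẋ = A(α)X + B(α)u + b` and of the cost. -/
structure LQData (D n m : ℕ) (Ω : Type*) where
  A : Fin D → Matrix (Fin n) (Fin n) ℝ
  B : Fin D → Matrix (Fin n) (Fin m) ℝ
  Q : Fin D → Matrix (Fin n) (Fin n) ℝ
  S : Fin D → Matrix (Fin m) (Fin n) ℝ
  R : Fin D → Matrix (Fin m) (Fin m) ℝ
  b : ℝ≥0 → Ω → Fin n → ℝ
  q : ℝ≥0 → Ω → Fin n → ℝ
  ρ : ℝ≥0 → Ω → Fin m → ℝ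

namespace LQData

variable {D n m : ℕ} {Ω : Type*} [mΩ : MeasurableSpace Ω]

/-- Assumptions on the weights: `Q(i)` symmetric, `R(i) > 0`, `Q(i) - S(i)ᵀ R(i)⁻¹ S(i) ≥ 0`. -/
structure WeightsOK (L : LQData D n m Ω) : Prop where
  Q_symm : ∀ i, (L.Q i).IsSymm
  R_pos : ∀ i, (L.R i).PosDef
  schur : ∀ i, (L.Q i - (L.S i)ᵀ * (L.R i)⁻¹ * L.S i).PosSemidef

/-- The set of stabilizers: those `Θ` for which there are `P(i) > 0` with
`P(i)[A(i)+B(i)Θ(i)] + [A(i)+B(i)Θ(i)]ᵀP(i) + ∑ⱼ πᵢⱼ P(j) < 0` for every `i`. -/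
def stabilizers (L : LQData D n m Ω) (G : Matrix (Fin D) (Fin D) ℝ) :
    Set (Fin D → Matrix (Fin m) (Fin n) ℝ) :=
  {Θ | ∃ P : Fin D → Matrix (Fin n) (Fin n) ℝ, (∀ i, (P i).PosDef) ∧
    ∀ i, (-(P i * (L.A i + L.B i * Θ i) + (L.A i + L.B i * Θ i)ᵀ * P i
      + ∑ j, G i j • P j)).PosDef}

/-- `X` solves `Ẋ(t) = A(α_t)X(t) + B(α_t)u(t) + b(t)`, `X(0) = x`, in integrated form. -/
def IsState (L : LQData D n m Ω) (α : ℝ≥0 → Ω → Fin D) (𝔽 : Filtration ℝ≥0 mΩ) (μ : Measure Ω)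
    (x : Fin n → ℝ) (u : ℝ≥0 → Ω → Fin m → ℝ) (X : ℝ≥0 → Ω → Fin n → ℝ) : Prop :=
  IsStronglyProgressive 𝔽 X ∧
    ∀ᵐ ω ∂μ, Continuous (fun t => X t ω) ∧
      ∀ t, X t ω = x + ∫ s in Set.Iic t,
        (L.A (α s ω) *ᵥ X s ω + L.B (α s ω) *ᵥ u s ω + L.b s ω) ∂timeMeasure

/-- The state process `X(·; x, u)` (the solution is unique up to indistinguishability). -/
def state (L : LQData D n m Ω) (α : ℝ≥0 → Ω → Fin D) (𝔽 : Filtration ℝ≥0 mΩ) (μ : Measure Ω)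
    (x : Fin n → ℝ) (u : ℝ≥0 → Ω → Fin m → ℝ) : ℝ≥0 → Ω → Fin n → ℝ :=
  Classical.epsilon (L.IsState α 𝔽 μ x u)

/-- The cost functional `J(x; u)`, with expectation under `μ`. -/
def cost (L : LQData D n m Ω) (α : ℝ≥0 → Ω → Fin D) (𝔽 : Filtration ℝ≥0 mΩ) (μ : Measure Ω)
    (x : Fin n → ℝ) (u : ℝ≥0 → Ω → Fin m → ℝ) : ℝ :=
  ∫ ω, ∫ t,
    ((Matrix.fromBlocks (L.Q (α t ω)) (L.S (α t ω))ᵀ (L.S (α t ω)) (L.R (α t ω)) *ᵥ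
        Sum.elim (L.state α 𝔽 μ x u t ω) (u t ω)) ⬝ᵥ
        Sum.elim (L.state α 𝔽 μ x u t ω) (u t ω)
      + 2 * (Sum.elim (L.q t ω) (L.ρ t ω) ⬝ᵥ
        Sum.elim (L.state α 𝔽 μ x u t ω) (u t ω))) ∂timeMeasure ∂μ

/-- Admissible controls: `u ∈ L²_𝒫` whose state process lies in `L²_𝔽`. -/
def admissible (L : LQData D n m Ω) (α : ℝ≥0 → Ω → Fin D) (𝔽 : Filtration ℝ≥0 mΩ)
    (μ : Measure Ω) (x : Fin n → ℝ) : Set (ℝ≥0 → Ω → Fin m → ℝ) :=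
  {u | u ∈ L2P 𝔽 μ ∧ L.state α 𝔽 μ x u ∈ L2F 𝔽 μ}

/-- The coefficients `A_Θ, B, Q_Θ, S_Θ, R, b, q_Θ, ρ` of the problem transformed by `Θ`. -/
def transform (L : LQData D n m Ω) (α : ℝ≥0 → Ω → Fin D)
    (Θ : Fin D → Matrix (Fin m) (Fin n) ℝ) : LQData D n m Ω where
  A i := L.A i + L.B i * Θ i
  B := L.B
  Q i := L.Q i + (L.S i)ᵀ * Θ i + (Θ i)ᵀ * L.S i + (Θ i)ᵀ * L.R i * Θ i
  S i := L.S i + L.R i * Θ i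
  R := L.R
  b := L.b
  q t ω := L.q t ω + (Θ (α t ω))ᵀ *ᵥ L.ρ t ω
  ρ := L.ρ

/-- The outcome `Θ(α)X_Θ(·; x, ν) + ν` of the feedback pair `(Θ, ν)`. -/
def feedback (L : LQData D n m Ω) (α : ℝ≥0 → Ω → Fin D) (𝔽 : Filtration ℝ≥0 mΩ) (μ : Measure Ω)
    (Θ : Fin D → Matrix (Fin m) (Fin n) ℝ) (x : Fin n → ℝ) (ν : ℝ≥0 → Ω → Fin m → ℝ) :
    ℝ≥0 → Ω → Fin m → ℝ :=
  fun t ω => Θ (α t ω) *ᵥ (L.transform α Θ).state α 𝔽 μ x ν t ω + ν t ω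

/-- `(Θ, ν)` is a closed-loop optimal control: `Θ` is a stabilizer, `ν` is in `L²_𝒫` whatever the
initial regime, and `J(x,i; Θ(α)X_Θ + ν) ≤ J(x,i; u)` for all `(x,i)` and all admissible `u`.
Here `P i` is the law under which the chain starts at `i`. -/
def IsClosedLoopOptimal (L : LQData D n m Ω) (G : Matrix (Fin D) (Fin D) ℝ)
    (α : ℝ≥0 → Ω → Fin D) (hα : ∀ t, Measurable (α t)) (P : Fin D → Measure Ω)
    (Θ : Fin D → Matrix (Fin m) (Fin n) ℝ) (ν : ℝ≥0 → Ω → Fin m → ℝ) : Prop :=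
  Θ ∈ L.stabilizers G ∧ (∀ i, ν ∈ L2P (augFiltration α hα (P i)) (P i)) ∧
    ∀ (x : Fin n → ℝ) (i : Fin D),
      ∀ u ∈ L.admissible α (augFiltration α hα (P i)) (P i) x,
        L.cost α (augFiltration α hα (P i)) (P i) x
            (L.feedback α (augFiltration α hα (P i)) (P i) Θ x ν)
          ≤ L.cost α (augFiltration α hα (P i)) (P i) x u

/-- `ν` is an open-loop optimal control, for the initial value `(x, i)`, of the problem transformed
by `Θ`: it minimizes `J_Θ(x,i; ·)` over `L²_𝒫`. -/
def IsOpenLoopOptimalTransformed (L : LQData D n m Ω)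
    (α : ℝ≥0 → Ω → Fin D) (hα : ∀ t, Measurable (α t)) (P : Fin D → Measure Ω)
    (Θ : Fin D → Matrix (Fin m) (Fin n) ℝ) (x : Fin n → ℝ) (i : Fin D)
    (ν : ℝ≥0 → Ω → Fin m → ℝ) : Prop :=
  ν ∈ L2P (augFiltration α hα (P i)) (P i) ∧
    IsMinOn ((L.transform α Θ).cost α (augFiltration α hα (P i)) (P i) x)
      (L2P (augFiltration α hα (P i)) (P i)) ν

end LQData

end

end MarkovLQ

/-! Everything rests on the substitution `u = Θ(α)X + v`. For fixed `(x, i)` it matches the controls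
`v` in `L²_𝒫` with the admissible controls `u`, up to null sets, and it turns the original state
equation and running cost into the transformed ones. Minimizing over all `v` and over all admissible
`u` is then the same problem, and the equivalence of the two optimality notions is immediate.

From `v` to `u` (`feedback_spec`): the transformed state `X` solves the original equation driven by
`u`, so pathwise uniqueness (`IsState.unique`) identifies it with the original state, and
`runningCost_transform` equates the integrands. Admissibility of `u` needs `X` square integrable on
the whole half-line (`memLp_state_transform`) and `Θ(α)X` to have a predictable version
(`exists_predictable_apply`). From `u` to `v` (`exists_feedback_of_admissible`): put `v = u -
Θ(α)X`; here admissibility itself supplies the square integrability.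

Square integrability is a Lyapunov argument. With `P` from the stabilizer condition, the drift of
`⟨P(α)X, X⟩` is at most `-c|X|² + C|f|²`, where `f` is the inhomogeneity. Integrating up to `T` and
dropping the nonnegative terminal term bounds `E∫₀ᵀ|X|²` uniformly in `T`. The energy identity
behind this comes from Dynkin's formula for `φ(α_t)Z_t` with `Z` absolutely continuous. It is
derived from the Markov property alone: conditioning at time `s` and factoring `e^{(t-s)G} =
e^{-sG}e^{tG}` writes `E[φ(α_t)Z_t]` as a finite sum of products of two functions of `t`, to which
the ordinary product rule applies.

Predictability holds because the chain has countably many jumps on each path, so it agrees with its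
left limits for almost every time. -/

namespace MarkovLQ

/-! ### Lebesgue measure on the half-line and primitives -/

section Time

variable {E : Type*} [NormedAddCommGroup E]

lemma measurableEmbedding_coe_nnreal : MeasurableEmbedding ((↑) : ℝ≥0 → ℝ) :=
  MeasurableEmbedding.subtype_coe measurableSet_Ici

lemma map_coe_timeMeasure : timeMeasure.map ((↑) : ℝ≥0 → ℝ) = volume.restrict (Set.Ici 0) := by
  rw [timeMeasure, measurableEmbedding_coe_nnreal.map_comap]
  congr 1
  ext x
  simp only [Set.mem_range, Set.mem_Ici]
  exact ⟨fun ⟨y, hy⟩ => hy ▸ y.2, fun h => ⟨⟨x, h⟩, rfl⟩⟩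

instance : NullSingletonClass timeMeasure := ⟨fun x => by
  rw [timeMeasure, measurableEmbedding_coe_nnreal.comap_apply]; simp⟩

lemma timeMeasure_Iic (t : ℝ≥0) : timeMeasure (Set.Iic t) = ENNReal.ofReal t := by
  rw [timeMeasure, measurableEmbedding_coe_nnreal.comap_apply]
  have : ((↑) : ℝ≥0 → ℝ) '' Set.Iic t = Set.Icc 0 (t : ℝ) := by
    ext x
    simp only [Set.mem_image, Set.mem_Iic, Set.mem_Icc]
    exact ⟨fun ⟨y, hy, h⟩ => h ▸ ⟨y.2, by exact_mod_cast hy⟩, fun h => ⟨⟨x, h.1⟩, h.2, rfl⟩⟩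
  rw [this]; simp

instance (t : ℝ≥0) : IsFiniteMeasure (timeMeasure.restrict (Set.Iic t)) :=
  ⟨by simp [timeMeasure_Iic]⟩

instance : IsLocallyFiniteMeasure timeMeasure := ⟨fun x => ⟨Set.Iic (x + 1),
  Iic_mem_nhds (lt_add_one x), by simp [timeMeasure_Iic]⟩⟩

lemma map_coe_timeMeasure_restrict (t : ℝ≥0) :
    (timeMeasure.restrict (Set.Iic t)).map ((↑) : ℝ≥0 → ℝ) =
      volume.restrict (Set.Icc 0 (t : ℝ)) := by
  have : Set.Iic t = ((↑) : ℝ≥0 → ℝ) ⁻¹' Set.Iic (t : ℝ) := by ext; simp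
  rw [this, ← measurableEmbedding_coe_nnreal.restrict_map, map_coe_timeMeasure,
    Measure.restrict_restrict measurableSet_Iic, Set.inter_comm, Set.Ici_inter_Iic]

/-- Moves to interval integrals over the real line, where the fundamental theorem of calculus and
Grönwall's inequality are available. -/
lemma setIntegral_Iic_eq [NormedSpace ℝ E] (f : ℝ≥0 → E) (t : ℝ≥0) :
    ∫ s in Set.Iic t, f s ∂timeMeasure = ∫ s in (0 : ℝ)..t, f s.toNNReal := by
  rw [intervalIntegral.integral_of_le t.coe_nonneg, ← integral_Icc_eq_integral_Ioc,
    ← map_coe_timeMeasure_restrict, measurableEmbedding_coe_nnreal.integral_map]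
  simp

lemma integrableOn_Iic_iff (f : ℝ≥0 → E) (t : ℝ≥0) :
    IntegrableOn f (Set.Iic t) timeMeasure ↔
      IntervalIntegrable (fun s : ℝ => f s.toNNReal) volume 0 t := by
  rw [intervalIntegrable_iff_integrableOn_Icc_of_le t.coe_nonneg, IntegrableOn, IntegrableOn,
    ← map_coe_timeMeasure_restrict, measurableEmbedding_coe_nnreal.integrable_map_iff]
  simp [Function.comp_def]

lemma continuous_setIntegral_Iic [NormedSpace ℝ E] {f : ℝ≥0 → E}
    (hf : ∀ t, IntegrableOn f (Set.Iic t) timeMeasure) :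
    Continuous fun t => ∫ s in Set.Iic t, f s ∂timeMeasure := by
  rw [continuous_iff_continuousAt]
  intro t
  have h1 : ContinuousOn (fun r : ℝ => ∫ s in (0 : ℝ)..r, f s.toNNReal)
      (Set.uIcc 0 ((t + 1 : ℝ≥0) : ℝ)) :=
    intervalIntegral.continuousOn_primitive_interval
      ((intervalIntegrable_iff').1 ((integrableOn_Iic_iff f (t + 1)).1 (hf _)))
  simp_rw [setIntegral_Iic_eq]
  have h2 : ContinuousOn (fun r : ℝ≥0 => ∫ s in (0 : ℝ)..r, f s.toNNReal) (Set.Iic (t + 1)) := by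
    refine h1.comp (f := ((↑) : ℝ≥0 → ℝ)) NNReal.continuous_coe.continuousOn ?_
    intro r hr
    rw [Set.uIcc_of_le (by positivity)]
    exact ⟨r.2, by exact_mod_cast hr⟩
  exact h2.continuousAt (Iic_mem_nhds (lt_add_one t))

lemma integrableOn_Iic_of_continuous {f : ℝ≥0 → E} (hf : Continuous f) (t : ℝ≥0) :
    IntegrableOn f (Set.Iic t) timeMeasure := by
  have : Set.Iic t = Set.Icc 0 t := by ext; simp
  rw [this]
  exact hf.continuousOn.integrableOn_compact isCompact_Icc

end Time

/-! ### Grönwall's inequality and integration by parts -/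

section Deterministic

/-- Grönwall's inequality in integral form. -/
lemma gronwall_integral {y : ℝ≥0 → ℝ} (hy : Continuous y) {K C : ℝ} (hC : 0 ≤ C) {T : ℝ≥0}
    (h : ∀ t ≤ T, y t ≤ K + C * ∫ s in Set.Iic t, y s ∂timeMeasure) :
    ∀ t ≤ T, y t ≤ K * Real.exp (C * t) := by
  intro t ht
  -- Composing with `toNNReal` extends `y` by the constant `y 0` to negative times, so the primitive
  -- is differentiable at every real point, 0 included.
  have hc : Continuous fun s : ℝ => y s.toNNReal := hy.comp continuous_real_toNNReal
  have hd : ∀ r : ℝ, HasDerivAt (fun r => K + C * ∫ s in (0 : ℝ)..r, y s.toNNReal)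
      (C * y r.toNNReal) r := fun r =>
    ((hc.integral_hasStrictDerivAt 0 r).hasDerivAt.const_mul C).const_add K
  -- The differential inequality is applied to the majorant `K + C ∫ y`, which is differentiable,
  -- since `y` itself is only continuous.
  have key := le_gronwallBound_of_liminf_deriv_right_le (δ := K) (K := C) (ε := 0) (a := 0)
    (b := (T : ℝ)) (f := fun r => K + C * ∫ s in (0 : ℝ)..r, y s.toNNReal)
    (f' := fun r => C * y r.toNNReal)
    (fun r _ => (hd r).continuousAt.continuousWithinAt)
    (fun r _ s hs => (hd r).hasDerivWithinAt.liminf_right_slope_le hs)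
    (by simp) (fun r hr => by
      have := h r.toNNReal (by
        rw [Real.toNNReal_le_iff_le_coe]; exact hr.2.le)
      rw [setIntegral_Iic_eq, Real.coe_toNNReal _ hr.1] at this
      simpa using mul_le_mul_of_nonneg_left this hC) t ⟨t.2, by exact_mod_cast ht⟩
  rw [gronwallBound_ε0, sub_zero] at key
  refine le_trans ?_ key
  have := h t ht
  rwa [setIntegral_Iic_eq] at this

/-- Product rule for two primitives of integrable functions. -/
lemma primitive_mul_primitive {f g x y : ℝ → ℝ} {T x₀ y₀ : ℝ} (hT : 0 ≤ T)
    (hf : IntervalIntegrable f volume 0 T) (hg : IntervalIntegrable g volume 0 T)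
    (hx : ∀ t ∈ Set.Icc 0 T, x t = x₀ + ∫ s in (0 : ℝ)..t, f s)
    (hy : ∀ t ∈ Set.Icc 0 T, y t = y₀ + ∫ s in (0 : ℝ)..t, g s) :
    x T * y T = x₀ * y₀ + ∫ s in (0 : ℝ)..T, (f s * y s + x s * g s) := by
  -- Primitives of integrable functions are absolutely continuous, so integration by parts applies;
  -- by Lebesgue differentiation their derivatives are `f` and `g` almost everywhere.
  have acc : ∀ c : ℝ, AbsolutelyContinuousOnInterval (fun _ => c) 0 T := fun c =>
    (LipschitzWith.const c).lipschitzOnWith.absolutelyContinuousOnInterval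
  have hF := (acc x₀).add (hf.absolutelyContinuousOnInterval_intervalIntegral Set.left_mem_uIcc)
  have hG := (acc y₀).add (hg.absolutelyContinuousOnInterval_intervalIntegral Set.left_mem_uIcc)
  have h := hF.integral_deriv_mul_eq_sub hG
  have e : ∫ s in (0 : ℝ)..T, (f s * y s + x s * g s) = x T * y T - x 0 * y 0 := by
    rw [hx T ⟨hT, le_rfl⟩, hy T ⟨hT, le_rfl⟩, hx 0 ⟨le_rfl, hT⟩, hy 0 ⟨le_rfl, hT⟩]
    simp only [Pi.add_apply] at h
    rw [← h]
    refine intervalIntegral.integral_congr_ae ?_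
    filter_upwards [hf.ae_hasDerivAt_integral, hg.ae_hasDerivAt_integral] with s h1 h2 hs
    have hs' : s ∈ Set.uIcc 0 T := Set.uIoc_subset_uIcc hs
    have d1 := ((h1 hs' 0 Set.left_mem_uIcc).const_add x₀).deriv
    have d2 := ((h2 hs' 0 Set.left_mem_uIcc).const_add y₀).deriv
    rw [Set.uIcc_of_le hT] at hs'
    have e1 : ((fun _ : ℝ => x₀) + fun x => ∫ v in (0 : ℝ)..x, f v) =
      fun x => x₀ + ∫ v in (0 : ℝ)..x, f v := rfl
    have e2 : ((fun _ : ℝ => y₀) + fun x => ∫ v in (0 : ℝ)..x, g v) =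
      fun x => y₀ + ∫ v in (0 : ℝ)..x, g v := rfl
    rw [e1, e2, d1, d2, hx s hs', hy s hs']
  rw [e, hx 0 ⟨le_rfl, hT⟩, hy 0 ⟨le_rfl, hT⟩]
  simp

end Deterministic

/-! ### Pathwise solution of switching linear equations -/

section Picard

variable {D : ℕ} {E : Type*} [NormedAddCommGroup E] [NormedSpace ℝ E]

/-- Picard iterates for `Ẏ = F(j)Y + f`, `Y(0) = x`. -/
noncomputable def picard (j : ℝ≥0 → Fin D) (F : Fin D → E →L[ℝ] E) (f : ℝ≥0 → E) (x : E) :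
    ℕ → ℝ≥0 → E
  | 0 => fun _ => x
  | k + 1 => fun t => x + ∫ s in Set.Iic t, (F (j s) (picard j F f x k s) + f s) ∂timeMeasure

lemma stronglyMeasurable_switching_apply {Ω : Type*} [MeasurableSpace Ω] {H : Type*}
    [NormedAddCommGroup H] [NormedSpace ℝ H] {j : Ω → Fin D} (hj : Measurable j)
    (F : Fin D → E →L[ℝ] H) {Y : Ω → E} (hY : StronglyMeasurable Y) :
    StronglyMeasurable fun s => F (j s) (Y s) := by
  have h1 : StronglyMeasurable fun s => F (j s) :=
    (StronglyMeasurable.of_discrete (f := F)).comp_measurable hj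
  exact isBoundedBilinearMap_apply.continuous.comp_stronglyMeasurable (h1.prodMk hY)

lemma exists_opNorm_bound {H : Type*} [NormedAddCommGroup H] [NormedSpace ℝ H]
    (F : Fin D → E →L[ℝ] H) : ∃ C, 0 ≤ C ∧ ∀ i, ‖F i‖ ≤ C :=
  ⟨∑ i, ‖F i‖, Finset.sum_nonneg fun _ _ => norm_nonneg _, fun i =>
    Finset.single_le_sum (f := fun i => ‖F i‖) (fun _ _ => norm_nonneg _) (Finset.mem_univ i)⟩

lemma integrableOn_switching_apply {j : ℝ≥0 → Fin D} (hj : Measurable j)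
    (F : Fin D → E →L[ℝ] E) {Y : ℝ≥0 → E} (hY : Continuous Y) (t : ℝ≥0) :
    IntegrableOn (fun s => F (j s) (Y s)) (Set.Iic t) timeMeasure := by
  obtain ⟨C, hC, hF⟩ := exists_opNorm_bound F
  refine ((integrableOn_Iic_of_continuous hY t).norm.const_mul C).mono'
    (stronglyMeasurable_switching_apply hj F hY.stronglyMeasurable).aestronglyMeasurable
    (ae_of_all _ fun s => ((F (j s)).le_opNorm _).trans ?_)
  gcongr
  exact hF _

lemma integrableOn_switching_affine {j : ℝ≥0 → Fin D} (hj : Measurable j)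
    (F : Fin D → E →L[ℝ] E) {Y f : ℝ≥0 → E} (hY : Continuous Y)
    (hf : ∀ t, IntegrableOn f (Set.Iic t) timeMeasure) (t : ℝ≥0) :
    IntegrableOn (fun s => F (j s) (Y s) + f s) (Set.Iic t) timeMeasure :=
  (integrableOn_switching_apply hj F hY t).add (hf t)

variable {j : ℝ≥0 → Fin D} {F : Fin D → E →L[ℝ] E} {f : ℝ≥0 → E} {x : E}

lemma continuous_picard (hj : Measurable j) (hf : ∀ t, IntegrableOn f (Set.Iic t) timeMeasure)
    (k : ℕ) : Continuous (picard j F f x k) := by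
  induction k with
  | zero => exact continuous_const
  | succ k ih =>
    exact continuous_const.add (continuous_setIntegral_Iic fun t =>
      (integrableOn_switching_apply hj F ih t).add (hf t))

/-- The weight `e^{2Ct}` makes the Picard map contract by the factor 1/2 on the whole half-line,
with no splitting into short intervals. -/
lemma integral_exp_bound (C : ℝ) (t : ℝ≥0) :
    ∫ s in Set.Iic t, C * Real.exp (2 * C * s) ∂timeMeasure ≤ Real.exp (2 * C * t) / 2 := by
  rw [setIntegral_Iic_eq (fun s : ℝ≥0 => C * Real.exp (2 * C * s))]
  have e : ∫ s in (0 : ℝ)..t, C * Real.exp (2 * C * (s.toNNReal : ℝ)) =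
      ∫ s in (0 : ℝ)..t, C * Real.exp (2 * C * s) := by
    refine intervalIntegral.integral_congr fun s hs => ?_
    rw [Set.uIcc_of_le t.coe_nonneg] at hs
    simp only [Real.coe_toNNReal _ hs.1]
  rw [e, intervalIntegral.integral_eq_sub_of_hasDerivAt
    (f := fun s => Real.exp (2 * C * s) / 2)
    (fun s _ => by
      have := (((hasDerivAt_id s).const_mul (2 * C)).exp).div_const 2
      convert! this using 1
      simp; ring)
    (Continuous.intervalIntegrable (by fun_prop) _ _)]
  have := Real.exp_pos (2 * C * 0)
  linarith

/-- Induction on `k`: each step costs a factor `C` inside a time integral, and `integral_exp_bound`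
turns it into 1/2. The prefactor, the integral of the first increment's integrand, grows with time
and so can be pulled out at its value at `t`. -/
lemma norm_picard_succ_sub_le {C : ℝ} (hC : 0 ≤ C) (hF : ∀ i, ‖F i‖ ≤ C) (hj : Measurable j)
    (hf : ∀ t, IntegrableOn f (Set.Iic t) timeMeasure) (k : ℕ) (t : ℝ≥0) :
    ‖picard j F f x (k + 1) t - picard j F f x k t‖ ≤
      (∫ s in Set.Iic t, ‖F (j s) x + f s‖ ∂timeMeasure) * Real.exp (2 * C * t) * (1 / 2) ^ k := by
  have hg : ∀ t, IntegrableOn (fun s => F (j s) x + f s) (Set.Iic t) timeMeasure := fun t =>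
    (integrableOn_switching_apply hj F continuous_const t).add (hf t)
  have hg0 : ∀ t, 0 ≤ ∫ s in Set.Iic t, ‖F (j s) x + f s‖ ∂timeMeasure := fun t =>
    integral_nonneg fun _ => norm_nonneg _
  induction k generalizing t with
  | zero =>
    simp only [picard, add_sub_cancel_left, pow_zero, mul_one]
    refine (norm_integral_le_integral_norm _).trans (le_mul_of_one_le_right (hg0 t) ?_)
    exact Real.one_le_exp (by positivity)
  | succ k ih =>
    have hc := continuous_picard (x := x) (F := F) hj hf
    have e : picard j F f x (k + 1 + 1) t - picard j F f x (k + 1) t =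
        ∫ s in Set.Iic t, F (j s) (picard j F f x (k + 1) s - picard j F f x k s) ∂timeMeasure := by
      have h1 : picard j F f x (k + 1 + 1) t = x + ∫ s in Set.Iic t,
        (F (j s) (picard j F f x (k + 1) s) + f s) ∂timeMeasure := rfl
      have h2 : picard j F f x (k + 1) t = x + ∫ s in Set.Iic t,
        (F (j s) (picard j F f x k s) + f s) ∂timeMeasure := rfl
      rw [h1, h2, add_sub_add_left_eq_sub, ← integral_sub
        (integrableOn_switching_affine hj F (hc _) hf t)
        (integrableOn_switching_affine hj F (hc _) hf t)]
      simp
    rw [e]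
    set g := ∫ s in Set.Iic t, ‖F (j s) x + f s‖ ∂timeMeasure with hgdef
    calc _ ≤ ∫ s in Set.Iic t, (C * Real.exp (2 * C * s)) * (g * (1 / 2) ^ k) ∂timeMeasure := by
          refine norm_integral_le_of_norm_le
            (integrableOn_Iic_of_continuous (by fun_prop) t) ?_
          refine (ae_restrict_iff' measurableSet_Iic).2 (ae_of_all _ fun s hs => ?_)
          have hgs : ∫ r in Set.Iic s, ‖F (j r) x + f r‖ ∂timeMeasure ≤ g :=
            setIntegral_mono_set (hg t).norm (ae_of_all _ fun _ => norm_nonneg _)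
              (Set.Iic_subset_Iic.2 hs).eventuallyLE
          calc _ ≤ C * ((∫ r in Set.Iic s, ‖F (j r) x + f r‖ ∂timeMeasure) *
                Real.exp (2 * C * s) * (1 / 2) ^ k) := by
                refine ((F (j s)).le_opNorm _).trans ?_
                exact mul_le_mul (hF _) (ih s) (norm_nonneg _) hC
            _ ≤ C * (g * Real.exp (2 * C * s) * (1 / 2) ^ k) := by gcongr
            _ = _ := by ring
      _ = (∫ s in Set.Iic t, (C * Real.exp (2 * C * s)) ∂timeMeasure) * (g * (1 / 2) ^ k) :=
          integral_mul_const _ _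
      _ ≤ Real.exp (2 * C * t) / 2 * (g * (1 / 2) ^ k) := by
          refine mul_le_mul_of_nonneg_right (integral_exp_bound C t)
            (mul_nonneg (hg0 t) (by positivity))
      _ = _ := by ring

/-- The Picard iterates converge to a continuous solution. -/
lemma exists_tendsto_picard [CompleteSpace E] (F : Fin D → E →L[ℝ] E) (x : E) (hj : Measurable j)
    (hf : ∀ t, IntegrableOn f (Set.Iic t) timeMeasure) :
    ∃ Y : ℝ≥0 → E, Continuous Y ∧ (∀ t, Tendsto (fun k => picard j F f x k t) atTop (𝓝 (Y t))) ∧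
      ∀ t, Y t = x + ∫ s in Set.Iic t, (F (j s) (Y s) + f s) ∂timeMeasure := by
  obtain ⟨C, hC, hF⟩ := exists_opNorm_bound F
  have hb := fun k t => norm_picard_succ_sub_le (x := x) hC hF hj hf k t
  set M : ℝ≥0 → ℝ := fun t =>
    (∫ s in Set.Iic t, ‖F (j s) x + f s‖ ∂timeMeasure) * Real.exp (2 * C * t) with hM
  have hd : ∀ t k, dist (picard j F f x k t) (picard j F f x (k + 1) t) ≤ M t * (1 / 2) ^ k :=
    fun t k => by rw [dist_comm, dist_eq_norm]; exact hb k t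
  choose Y hY using fun t =>
    cauchySeq_tendsto_of_complete (cauchySeq_of_le_geometric (1 / 2) (M t) (by norm_num) (hd t))
  have hMm : ∀ s t, s ≤ t → M s ≤ M t := fun s t hst => by
    have h1 : ∫ r in Set.Iic s, ‖F (j r) x + f r‖ ∂timeMeasure ≤
        ∫ r in Set.Iic t, ‖F (j r) x + f r‖ ∂timeMeasure :=
      setIntegral_mono_set
        ((integrableOn_switching_apply hj F continuous_const t).add (hf t)).norm
        (ae_of_all _ fun _ => norm_nonneg _) (Set.Iic_subset_Iic.2 hst).eventuallyLE
    exact mul_le_mul h1 (Real.exp_le_exp.2 (by gcongr)) (Real.exp_pos _).le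
      (integral_nonneg fun _ => norm_nonneg _)
  have hM0 : ∀ t, 0 ≤ M t := fun t =>
    mul_nonneg (integral_nonneg fun _ => norm_nonneg _) (Real.exp_pos _).le
  -- The tail of a geometric series of ratio 1/2 gives the factor 2; using it at `0` and at `k`
  -- below gives the bound `‖x‖ + 4 * M t`, uniform in `k`, that serves for dominated convergence.
  have hdY : ∀ k t, ‖picard j F f x k t - Y t‖ ≤ 2 * M t := fun k t => by
    rw [← dist_eq_norm]
    refine (dist_le_of_le_geometric_of_tendsto (1 / 2) (M t) (by norm_num) (hd t) (hY t) k).trans ?_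
    have : (1 / 2 : ℝ) ^ k ≤ 1 := pow_le_one₀ (by norm_num) (by norm_num)
    have := mul_le_mul_of_nonneg_left this (hM0 t)
    rw [div_le_iff₀ (by norm_num)]
    linarith
  have hp : ∀ k t, ‖picard j F f x k t‖ ≤ ‖x‖ + 4 * M t := fun k t => by
    have h0 := hdY 0 t
    have hk := hdY k t
    have e : picard j F f x k t = x - (picard j F f x 0 t - Y t) + (picard j F f x k t - Y t) := by
      simp [picard]
    rw [e]
    refine (norm_add_le _ _).trans ?_
    have := norm_sub_le x (picard j F f x 0 t - Y t)
    linarith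
  have hYb : ∀ t, ‖Y t‖ ≤ ‖x‖ + 4 * M t := fun t =>
    le_of_tendsto (hY t).norm (Eventually.of_forall fun k => hp k t)
  have hYm : StronglyMeasurable Y := stronglyMeasurable_of_tendsto atTop
    (fun k => (continuous_picard hj hf k).stronglyMeasurable) (tendsto_pi_nhds.2 hY)
  have hFb : ∀ (y : E) s t, s ≤ t → ‖y‖ ≤ ‖x‖ + 4 * M s →
      ‖F (j s) y‖ ≤ C * (‖x‖ + 4 * M t) := fun y s t hst hy => by
    refine ((F (j s)).le_opNorm _).trans (mul_le_mul (hF _) (hy.trans ?_) (norm_nonneg _) hC)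
    linarith [hMm s t hst]
  have hYi : ∀ t, IntegrableOn (fun s => F (j s) (Y s) + f s) (Set.Iic t) timeMeasure := fun t => by
    refine Integrable.add ?_ (hf t)
    refine (integrable_const (C * (‖x‖ + 4 * M t))).mono'
      (stronglyMeasurable_switching_apply hj F hYm).aestronglyMeasurable ?_
    exact (ae_restrict_iff' measurableSet_Iic).2 (ae_of_all _ fun s hs => hFb _ s t hs (hYb s))
  have hsol : ∀ t, Y t = x + ∫ s in Set.Iic t, (F (j s) (Y s) + f s) ∂timeMeasure := fun t => by
    refine tendsto_nhds_unique ((tendsto_add_atTop_iff_nat 1).2 (hY t)) ?_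
    refine Tendsto.const_add x (tendsto_integral_of_dominated_convergence
      (fun s => C * (‖x‖ + 4 * M t) + ‖f s‖) (fun k =>
        ((integrableOn_switching_apply hj F (continuous_picard hj hf k) t).add
          (hf t)).aestronglyMeasurable) ((integrable_const _).add (hf t).norm) (fun k => ?_) ?_)
    · exact (ae_restrict_iff' measurableSet_Iic).2 (ae_of_all _ fun s hs =>
        (norm_add_le _ _).trans (add_le_add (hFb _ s t hs (hp k s)) le_rfl))
    · exact ae_of_all _ fun s => (((F (j s)).continuous.tendsto _).comp (hY s)).add_const _
  refine ⟨Y, ?_, hY, hsol⟩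
  rw [funext hsol]
  exact continuous_const.add (continuous_setIntegral_Iic hYi)

/-- A priori bound for solutions of `Ẏ = F(j)Y + f`. -/
lemma norm_solution_le {C : ℝ} (hC : 0 ≤ C) (hF : ∀ i, ‖F i‖ ≤ C) (hj : Measurable j)
    (hf : ∀ t, IntegrableOn f (Set.Iic t) timeMeasure) {Y : ℝ≥0 → E} (hY : Continuous Y)
    (hsol : ∀ t, Y t = x + ∫ s in Set.Iic t, (F (j s) (Y s) + f s) ∂timeMeasure)
    {t T : ℝ≥0} (htT : t ≤ T) :
    ‖Y t‖ ≤ (‖x‖ + ∫ s in Set.Iic T, ‖f s‖ ∂timeMeasure) * Real.exp (C * t) := by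
  refine gronwall_integral hY.norm hC (fun r hr => ?_) t htT
  have hi := integrableOn_switching_apply hj F hY r
  rw [hsol r, integral_add hi (hf r), ← add_assoc, add_right_comm]
  refine (norm_add_le _ _).trans (add_le_add ((norm_add_le _ _).trans (add_le_add le_rfl ?_)) ?_)
  · exact (norm_integral_le_integral_norm _).trans (setIntegral_mono_set (hf T).norm
      (ae_of_all _ fun _ => norm_nonneg _) (Set.Iic_subset_Iic.2 hr).eventuallyLE)
  · rw [← integral_const_mul]
    refine norm_integral_le_of_norm_le
      ((integrableOn_Iic_of_continuous hY.norm r).const_mul C) (ae_of_all _ fun s => ?_)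
    exact ((F (j s)).le_opNorm _).trans (mul_le_mul_of_nonneg_right (hF _) (norm_nonneg _))

/-- The difference of two solutions solves the homogeneous equation from 0, so the a priori bound
forces it to vanish. -/
lemma solution_unique (hj : Measurable j)
    (hf : ∀ t, IntegrableOn f (Set.Iic t) timeMeasure) {Y Z : ℝ≥0 → E} (hY : Continuous Y)
    (hZ : Continuous Z)
    (hYs : ∀ t, Y t = x + ∫ s in Set.Iic t, (F (j s) (Y s) + f s) ∂timeMeasure)
    (hZs : ∀ t, Z t = x + ∫ s in Set.Iic t, (F (j s) (Z s) + f s) ∂timeMeasure) : Y = Z := by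
  obtain ⟨C, hC, hF⟩ := exists_opNorm_bound F
  funext t
  have h := norm_solution_le (x := 0) (f := fun _ => (0 : E)) (Y := fun t => Y t - Z t) hC hF hj
    (fun t => integrable_zero _ _ _) (hY.sub hZ) (fun t => by
      rw [hYs t, hZs t, add_sub_add_left_eq_sub, ← integral_sub
        (integrableOn_switching_affine hj F hY hf t)
        (integrableOn_switching_affine hj F hZ hf t)]
      simp) (le_refl t)
  simp only [norm_zero, integral_zero, add_zero, zero_mul, norm_le_zero_iff] at h
  exact sub_eq_zero.1 h

end Picard

/-! ### Progressive and predictable processes -/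

section Measurability

variable {Ω : Type*} {mΩ : MeasurableSpace Ω} {𝔽 : Filtration ℝ≥0 mΩ}

/-- A progressive process is jointly measurable. -/
lemma stronglyMeasurable_uncurry_of_progressive {β : Type*} [TopologicalSpace β]
    [TopologicalSpace.PseudoMetrizableSpace β] {X : ℝ≥0 → Ω → β}
    (hX : IsStronglyProgressive 𝔽 X) : StronglyMeasurable (Function.uncurry X) := by
  -- The process stopped at time `k` is jointly measurable by progressivity on `[0, k]`, and at each
  -- point it is eventually the process itself.
  refine stronglyMeasurable_of_tendsto (atTop : Filter ℕ)
    (f := fun k p => X (min p.1 (k : ℝ≥0)) p.2) (fun k => ?_) ?_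
  · have hm : @Measurable (ℝ≥0 × Ω) (Set.Iic (k : ℝ≥0) × Ω) _
        (Subtype.instMeasurableSpace.prod (𝔽 (k : ℝ≥0)))
        fun p => (⟨min p.1 (k : ℝ≥0), Set.mem_Iic.2 (min_le_right _ _)⟩, p.2) := by
      have h1 : Measurable fun p : ℝ≥0 × Ω => (⟨min p.1 (k : ℝ≥0), Set.mem_Iic.2
          (min_le_right _ _)⟩ : Set.Iic (k : ℝ≥0)) :=
        (measurable_fst.min measurable_const).subtype_mk
      exact @Measurable.prodMk _ _ _ _ _ (𝔽 (k : ℝ≥0)) _ _ h1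
        (measurable_snd.mono le_rfl (𝔽.le _))
    exact (hX (k : ℝ≥0)).comp_measurable hm
  · refine tendsto_pi_nhds.2 fun p => tendsto_const_nhds.congr' ?_
    obtain ⟨K, hK⟩ := exists_nat_ge p.1
    filter_upwards [eventually_ge_atTop K] with k hk
    have : p.1 ≤ (k : ℝ≥0) := hK.trans (by exact_mod_cast hk)
    simp [Function.uncurry, min_eq_left this]

/-- The grid point of mesh `1 / (k + 1)` lying just to the right of `t`. -/
noncomputable def gridRight (k : ℕ) (t : ℝ≥0) : ℝ≥0 := (⌊(k + 1) * t⌋₊ + 1) / (k + 1)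

lemma lt_gridRight (k : ℕ) (t : ℝ≥0) : t < gridRight k t := by
  rw [gridRight, lt_div_iff₀ (by positivity), mul_comm]
  exact Nat.lt_floor_add_one _

lemma gridRight_le (k : ℕ) (t : ℝ≥0) : gridRight k t ≤ t + 1 / (k + 1) := by
  rw [gridRight, div_le_iff₀ (by positivity), add_mul t, one_div_mul_cancel (by positivity)]
  gcongr
  rw [mul_comm t]
  exact Nat.floor_le (by positivity)

lemma tendsto_one_div_nnreal : Tendsto (fun k : ℕ => (1 : ℝ≥0) / (k + 1)) atTop (𝓝 0) := by
  rw [← NNReal.tendsto_coe]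
  simpa using tendsto_one_div_add_atTop_nhds_zero_nat (𝕜 := ℝ)

lemma tendsto_gridRight (t : ℝ≥0) : Tendsto (fun k => gridRight k t) atTop (𝓝 t) := by
  refine tendsto_of_tendsto_of_tendsto_of_le_of_le tendsto_const_nhds ?_
    (fun k => (lt_gridRight k t).le) (fun k => gridRight_le k t)
  simpa using tendsto_one_div_nnreal.const_add t

/-- A right-continuous adapted process is progressive. -/
lemma isStronglyProgressive_of_rightContinuous {β : Type*} [TopologicalSpace β]
    [TopologicalSpace.PseudoMetrizableSpace β] [SecondCountableTopology β] [MeasurableSpace β]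
    [BorelSpace β] {X : ℝ≥0 → Ω → β} (hX : StronglyAdapted 𝔽 X)
    (hc : ∀ ω t, ContinuousWithinAt (fun s => X s ω) (Set.Ici t) t) :
    IsStronglyProgressive 𝔽 X := by
  intro i
  -- Sampling at grid points to the right, capped at `i` to remain `𝔽 i`-measurable, converges by
  -- right continuity. Each approximation depends on time only through an integer index, hence is
  -- jointly measurable.
  refine @stronglyMeasurable_of_tendsto (Set.Iic i × Ω) β ℕ
    (MeasurableSpace.prod _ (𝔽 i)) _ _ atTop _ _
    (fun k p => X (min (gridRight k p.1) i) p.2) _ (fun k => ?_) ?_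
  · refine Measurable.stronglyMeasurable ?_
    have h1 : @Measurable (ℕ × Ω) β (MeasurableSpace.prod _ (𝔽 i)) _
        fun q => X (min ((q.1 + 1 : ℝ≥0) / (k + 1)) i) q.2 :=
      @measurable_from_prod_countable_right _ _ _ _ (𝔽 i) _ _ _ _
        fun m => ((hX (min ((m + 1 : ℝ≥0) / (k + 1)) i)).mono
          (𝔽.mono (min_le_right _ _))).measurable
    have h2 : @Measurable (Set.Iic i × Ω) (ℕ × Ω)
        (MeasurableSpace.prod Subtype.instMeasurableSpace (𝔽 i))
        (MeasurableSpace.prod Nat.instMeasurableSpace (𝔽 i))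
        fun p => (⌊(k + 1) * (p.1 : ℝ≥0)⌋₊, p.2) := by
      have h3 : Measurable fun s : Set.Iic i => ⌊(k + 1) * (s : ℝ≥0)⌋₊ :=
        Nat.measurable_floor.comp (measurable_subtype_coe.const_mul _)
      exact @Measurable.prodMk _ (MeasurableSpace.prod Subtype.instMeasurableSpace (𝔽 i)) _ _ _
        (𝔽 i) _ _ (h3.comp (@measurable_fst _ _ _ (𝔽 i))) (@measurable_snd _ _ _ (𝔽 i))
    have e : (fun p : Set.Iic i × Ω => X (min (gridRight k p.1) i) p.2) =
        (fun q : ℕ × Ω => X (min ((q.1 + 1 : ℝ≥0) / (k + 1)) i) q.2) ∘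
          fun p => (⌊(k + 1) * (p.1 : ℝ≥0)⌋₊, p.2) := by
      funext p
      simp only [gridRight, Function.comp_apply]
    rw [e]
    exact h1.comp h2
  · refine tendsto_pi_nhds.2 fun p => ?_
    have ht : Tendsto (fun k => min (gridRight k p.1) i) atTop (𝓝[Set.Ici (p.1 : ℝ≥0)] p.1) := by
      refine tendsto_nhdsWithin_iff.2 ⟨?_, Eventually.of_forall fun k =>
        le_min (lt_gridRight k p.1).le p.1.2⟩
      have := (tendsto_gridRight (p.1 : ℝ≥0)).min (tendsto_const_nhds (x := i))
      rwa [min_eq_left p.1.2] at this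
    exact (hc p.2 p.1).tendsto.comp ht

/-- The grid point of mesh `1 / (k + 1)` lying just to the left of `t` (and `0` if `t = 0`). -/
noncomputable def gridLeft (k : ℕ) (t : ℝ≥0) : ℝ≥0 := ((⌈(k + 1) * t⌉₊ - 1 : ℕ) : ℝ≥0) / (k + 1)

lemma gridLeft_eq_iff {k m : ℕ} {t : ℝ≥0} (ht : 0 < t) :
    ⌈(k + 1) * t⌉₊ - 1 = m ↔ t ∈ Set.Ioc ((m : ℝ≥0) / (k + 1)) ((m + 1 : ℝ≥0) / (k + 1)) := by
  have h0 : 0 < ⌈(k + 1) * t⌉₊ := Nat.ceil_pos.2 (by positivity)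
  have : ⌈(k + 1) * t⌉₊ - 1 = m ↔ ⌈(k + 1) * t⌉₊ = m + 1 := by omega
  rw [this, Nat.ceil_eq_iff (Nat.succ_ne_zero _), Set.mem_Ioc, div_lt_iff₀ (by positivity),
    le_div_iff₀ (by positivity), mul_comm t]
  simp

lemma gridLeft_lt {k : ℕ} {t : ℝ≥0} (ht : 0 < t) : gridLeft k t < t :=
  ((gridLeft_eq_iff ht).1 rfl).1

lemma le_gridLeft_add (k : ℕ) {t : ℝ≥0} (ht : 0 < t) : t ≤ gridLeft k t + 1 / (k + 1) := by
  have := ((gridLeft_eq_iff (k := k) ht).1 rfl).2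
  rwa [add_div] at this

lemma tendsto_gridLeft {t : ℝ≥0} (ht : 0 < t) :
    Tendsto (fun k => gridLeft k t) atTop (𝓝[<] t) := by
  refine tendsto_nhdsWithin_iff.2 ⟨?_, Eventually.of_forall fun k => gridLeft_lt ht⟩
  refine tendsto_of_tendsto_of_tendsto_of_le_of_le (g := fun k : ℕ => t - 1 / (k + 1)) ?_
    tendsto_const_nhds (fun k => ?_) (fun k => (gridLeft_lt ht).le)
  · simpa using (tendsto_const_nhds (x := t)).sub tendsto_one_div_nnreal
  · exact tsub_le_iff_right.2 (le_gridLeft_add k ht)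

/-- The process of left limits of an adapted process is predictable. -/
lemma isStronglyPredictable_of_leftLimit {β : Type*} [TopologicalSpace β]
    [TopologicalSpace.PseudoMetrizableSpace β] [SecondCountableTopology β] [MeasurableSpace β]
    [BorelSpace β] {X Y : ℝ≥0 → Ω → β} (hX : StronglyAdapted 𝔽 X) (h0 : Y 0 = X 0)
    (hl : ∀ ω t, 0 < t → Tendsto (fun s => X s ω) (𝓝[<] t) (𝓝 (Y t ω))) :
    IsStronglyPredictable 𝔽 Y := by
  refine @stronglyMeasurable_of_tendsto (ℝ≥0 × Ω) β ℕ 𝔽.predictable _ _ atTop _ _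
    (fun k p => X (gridLeft k p.1) p.2) _ (fun k => ?_) ?_
  · refine Measurable.stronglyMeasurable fun S hS => ?_
    -- Each approximation holds the value at the left endpoint over a half-open interval, so its
    -- preimages are countable unions of predictable rectangles. At `t = 0` the truncated
    -- subtraction gives index 0, which is covered by the rectangle over `{⊥}`.
    have e : (fun p : ℝ≥0 × Ω => X (gridLeft k p.1) p.2) ⁻¹' S =
        ({⊥} ×ˢ (X ⊥ ⁻¹' S)) ∪ ⋃ m : ℕ, Set.Ioc ((m : ℝ≥0) / (k + 1)) ((m + 1 : ℝ≥0) / (k + 1)) ×ˢ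
          (X ((m : ℝ≥0) / (k + 1)) ⁻¹' S) := by
      ext ⟨t, ω⟩
      simp only [Set.mem_preimage, Set.mem_union, Set.mem_prod, Set.mem_singleton_iff,
        Set.mem_iUnion]
      rcases eq_or_ne t 0 with rfl | ht
      · simp [gridLeft]
      · have htp : 0 < t := pos_iff_ne_zero.2 ht
        simp only [bot_eq_zero', ht, false_and, false_or]
        constructor
        · intro h
          exact ⟨⌈(k + 1) * t⌉₊ - 1, (gridLeft_eq_iff htp).1 rfl, h⟩
        · rintro ⟨m, hm, h⟩
          have := (gridLeft_eq_iff htp).2 hm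
          rw [gridLeft, this]
          exact h
    rw [e]
    refine (measurableSet_predictable_singleton_bot_prod ((hX _).measurable hS)).union
      (MeasurableSet.iUnion fun m => measurableSet_predictable_Ioc_prod _ _ ((hX _).measurable hS))
  · refine tendsto_pi_nhds.2 fun p => ?_
    rcases eq_or_ne p.1 0 with h | h
    · have e : Function.uncurry Y p = X 0 p.2 := by simp [Function.uncurry, h, h0]
      rw [e]
      refine tendsto_const_nhds.congr fun k => ?_
      simp [gridLeft, h]
    · have htp : 0 < p.1 := pos_iff_ne_zero.2 h
      exact (hl p.2 p.1 htp).comp (tendsto_gridLeft htp)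

/-- The running time integral of a progressive process is adapted. -/
lemma stronglyAdapted_setIntegral_Iic {E : Type*} [NormedAddCommGroup E] [NormedSpace ℝ E]
    {f : ℝ≥0 → Ω → E} (hf : IsStronglyProgressive 𝔽 f) :
    StronglyAdapted 𝔽 fun t ω => ∫ s in Set.Iic t, f s ω ∂timeMeasure := by
  intro t
  -- Passing to the subtype `Set.Iic t` matches the product space on which progressivity gives `𝔽
  -- t`-measurability, so Fubini measurability applies.
  have e : (fun ω => ∫ s in Set.Iic t, f s ω ∂timeMeasure) =
      fun ω => ∫ s : Set.Iic t, f s ω ∂(timeMeasure.comap Subtype.val) := by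
    funext ω
    rw [integral_subtype_comap measurableSet_Iic (fun s => f s ω)]
  have : IsFiniteMeasure (timeMeasure.comap (Subtype.val : Set.Iic t → ℝ≥0)) := by
    refine ⟨?_⟩
    rw [(MeasurableEmbedding.subtype_coe measurableSet_Iic).comap_apply, Set.image_univ,
      Subtype.range_coe, timeMeasure_Iic]
    exact ENNReal.ofReal_lt_top
  have h := @StronglyMeasurable.integral_prod_left' _ _ _ _ (𝔽 t)
    (timeMeasure.comap (Subtype.val : Set.Iic t → ℝ≥0)) _ _ _ _ (hf t)
  rw [← e] at h
  exact h

lemma isStronglyProgressive_indicator {E : Type*} [TopologicalSpace E] [Zero E]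
    {f : ℝ≥0 → Ω → E} (hf : IsStronglyProgressive 𝔽 f) {N : Set Ω} (hN : MeasurableSet[𝔽 0] N) :
    IsStronglyProgressive 𝔽 fun t => N.indicator (f t) := by
  intro i
  have : (fun p : Set.Iic i × Ω => N.indicator (f p.1) p.2) =
      (Prod.snd ⁻¹' N).indicator fun p : Set.Iic i × Ω => f p.1 p.2 := by
    ext p
    by_cases h : p.2 ∈ N
    · rw [Set.indicator_of_mem h, Set.indicator_of_mem (by exact h)]
    · rw [Set.indicator_of_notMem h, Set.indicator_of_notMem (by exact h)]
  rw [this]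
  exact (hf i).indicator ((@measurable_snd _ _ _ (𝔽 i)) (𝔽.mono (zero_le (a := i)) _ hN))

lemma isStronglyProgressive_switching_apply {D : ℕ} {E H : Type*} [NormedAddCommGroup E]
    [NormedSpace ℝ E] [NormedAddCommGroup H] [NormedSpace ℝ H] {α : ℝ≥0 → Ω → Fin D}
    (hα : IsStronglyProgressive 𝔽 α) (F : Fin D → E →L[ℝ] H) {Y : ℝ≥0 → Ω → E}
    (hY : IsStronglyProgressive 𝔽 Y) : IsStronglyProgressive 𝔽 fun t ω => F (α t ω) (Y t ω) :=
  fun i => @stronglyMeasurable_switching_apply D E _ _ _ (MeasurableSpace.prod _ (𝔽 i)) H _ _ _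
    (hα i).measurable F _ (hY i)

end Measurability

/-! ### Augmented filtration and jumps of the chain -/

section ChainPaths

variable {D : ℕ} {Ω : Type*} [mΩ : MeasurableSpace Ω]

lemma measurableSet_augFiltration_of_null (α : ℝ≥0 → Ω → Fin D) (hα : ∀ t, Measurable (α t))
    (μ : Measure Ω) {N : Set Ω} (hN : MeasurableSet N) (h0 : μ N = 0) (t : ℝ≥0) :
    MeasurableSet[augFiltration α hα μ t] N := by
  have h : nullSigma μ ≤ augFiltration α hα μ t := le_sup_right (a := Filtration.natural α _ t)
  exact h _ (MeasurableSpace.measurableSet_generateFrom ⟨hN, h0⟩)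

lemma stronglyAdapted_augFiltration (α : ℝ≥0 → Ω → Fin D) (hα : ∀ t, Measurable (α t))
    (μ : Measure Ω) : StronglyAdapted (augFiltration α hα μ) α := fun t =>
  ((Filtration.stronglyAdapted_natural fun t => (hα t).stronglyMeasurable) t).mono
    (le_sup_left (b := nullSigma μ))

/-- A right-continuous path in a finite set that has left limits has countably many jumps. -/
lemma countable_jumps {a l : ℝ≥0 → Fin D}
    (hr : ∀ t, ContinuousWithinAt a (Set.Ici t) t)
    (hl : ∀ t, 0 < t → Tendsto a (𝓝[<] t) (𝓝 (l t))) : {t | l t ≠ a t}.Countable := by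
  -- It suffices that every jump time be isolated from the right among jump times: the path is
  -- constant on some `[t, u)`, so no point of `(t, u)` is a jump.
  refine (countable_setOfPred_isolated_right_within (s := {t | l t ≠ a t})).mono ?_
  intro t ht
  refine ⟨ht, ?_⟩
  obtain ⟨u, htu, hu⟩ : ∃ u > t, ∀ s ∈ Set.Ico t u, a s = a t := by
    have h : ∀ᶠ s in 𝓝[≥] t, a s = a t := by
      have := (hr t).tendsto
      rw [nhds_discrete, tendsto_pure] at this
      exact this
    obtain ⟨u, hu, h'⟩ := mem_nhdsGE_iff_exists_Ico_subset.1 h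
    exact ⟨u, hu, fun s hs => h' hs⟩
  rw [← empty_mem_iff_bot, mem_nhdsWithin_iff_exists_mem_nhds_inter]
  refine ⟨Set.Iio u, Iio_mem_nhds htu, ?_⟩
  rintro r ⟨hru, hrs, htr⟩
  have hne : (𝓝[<] r).NeBot := nhdsLT_neBot_of_exists_lt ⟨t, htr⟩
  refine hrs (tendsto_nhds_unique (hl r (bot_le.trans_lt htr)) ?_)
  refine tendsto_const_nhds.congr' ?_
  have : Set.Ioo t r ∈ 𝓝[<] r := Ioo_mem_nhdsLT htr
  filter_upwards [this] with s hs
  rw [hu s ⟨hs.1.le, hs.2.trans hru⟩, hu r ⟨le_of_lt htr, hru⟩]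

end ChainPaths

/-! ### From product-measure statements to paths -/

section SquareIntegrable

variable {Ω : Type*} [mΩ : MeasurableSpace Ω] {μ : Measure Ω}

lemma ae_ae_of_ae_prod_right [SFinite μ] {p : ℝ≥0 × Ω → Prop} (h : ∀ᵐ z ∂timeMeasure.prod μ, p z) :
    ∀ᵐ ω ∂μ, ∀ᵐ t ∂timeMeasure, p (t, ω) :=
  Measure.ae_ae_of_ae_prod
    ((Measure.measurePreserving_swap (μ := μ) (ν := timeMeasure)).quasiMeasurePreserving.ae h)

lemma ae_prod_of_ae_right [SFinite μ] {p : Ω → Prop} (h : ∀ᵐ ω ∂μ, p ω) :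
    ∀ᵐ z ∂timeMeasure.prod μ, p z.2 :=
  Measure.quasiMeasurePreserving_snd.ae h

lemma ae_memLp_path [SFinite μ] {E : Type*} [NormedAddCommGroup E] {f : ℝ≥0 → Ω → E}
    (hf : MemLp (Function.uncurry f) 2 (timeMeasure.prod μ)) :
    ∀ᵐ ω ∂μ, MemLp (fun t => f t ω) 2 timeMeasure := by
  have h1 : ∀ᵐ ω ∂μ, AEStronglyMeasurable (fun t => f t ω) timeMeasure :=
    (hf.1.prod_swap (f := Function.uncurry f)).prodMk_left
  have h2 : ∀ᵐ ω ∂μ, Integrable (fun t => ‖f t ω‖ ^ 2) timeMeasure :=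
    ((memLp_two_iff_integrable_sq_norm hf.1).1 hf).prod_left_ae
  filter_upwards [h1, h2] with ω h1 h2
  exact (memLp_two_iff_integrable_sq_norm h1).2 h2

lemma integrableOn_Iic_of_memLp {E : Type*} [NormedAddCommGroup E] {f : ℝ≥0 → E}
    (hf : MemLp f 2 timeMeasure) (t : ℝ≥0) : IntegrableOn f (Set.Iic t) timeMeasure :=
  (hf.restrict (Set.Iic t)).integrable one_le_two

end SquareIntegrable

/-! ### Adapted solutions of the random equation -/

section Solutions

variable {D : ℕ} {Ω : Type*} {mΩ : MeasurableSpace Ω} {𝔽 : Filtration ℝ≥0 mΩ} {μ : Measure Ω}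
  {E : Type*} [NormedAddCommGroup E] [NormedSpace ℝ E]

lemma measurable_path {α : ℝ≥0 → Ω → Fin D} (hα : IsStronglyProgressive 𝔽 α) (ω : Ω) :
    Measurable fun s => α s ω :=
  (stronglyMeasurable_uncurry_of_progressive hα).measurable.comp measurable_prodMk_right

/-- Existence of a continuous adapted solution of `Ẋ = F(α)X + f`, `X(0) = x`. -/
lemma exists_progressive_solution [CompleteSpace E] [SecondCountableTopology E]
    (hnull : ∀ N, MeasurableSet N → μ N = 0 → MeasurableSet[𝔽 0] N)
    {α : ℝ≥0 → Ω → Fin D} (hα : IsStronglyProgressive 𝔽 α) (F : Fin D → E →L[ℝ] E)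
    {f : ℝ≥0 → Ω → E} (hf : IsStronglyProgressive 𝔽 f)
    (hfi : ∀ᵐ ω ∂μ, ∀ t, IntegrableOn (fun s => f s ω) (Set.Iic t) timeMeasure) (x : E) :
    ∃ X : ℝ≥0 → Ω → E, IsStronglyProgressive 𝔽 X ∧ (∀ ω, Continuous fun t => X t ω) ∧
      ∀ᵐ ω ∂μ, ∀ t, X t ω =
        x + ∫ s in Set.Iic t, (F (α s ω) (X s ω) + f s ω) ∂timeMeasure := by
  -- The exceptional paths lie in a null set `N`, which belongs to `𝔽 0` by augmentation. Setting
  -- `f` to 0 there keeps it progressive and lets the iteration run on every path.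
  obtain ⟨N, hNs, hNm, hN0⟩ := exists_measurable_superset_of_null hfi
  set g : ℝ≥0 → Ω → E := fun t => Nᶜ.indicator (f t) with hg
  have hgp : IsStronglyProgressive 𝔽 g :=
    isStronglyProgressive_indicator hf (hnull N hNm hN0).compl
  have hgi : ∀ ω t, IntegrableOn (fun s => g s ω) (Set.Iic t) timeMeasure := by
    intro ω t
    by_cases h : ω ∈ N
    · have : (fun s => g s ω) = fun _ => 0 := by
        funext s; exact Set.indicator_of_notMem (by simpa using h) _
      rw [this]; exact integrable_zero _ _ _
    · have : (fun s => g s ω) = fun s => f s ω := by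
        funext s; exact Set.indicator_of_mem (by exact h) _
      rw [this]
      by_contra hc
      exact h (hNs fun h' => hc (h' t))
  choose X hXc hXt hXs using fun ω =>
    exists_tendsto_picard (f := fun s => g s ω) F x (measurable_path hα ω) (hgi ω)
  -- Adaptedness is inherited from the iterates: each is a time integral of a progressive process,
  -- and the solution is their pointwise limit.
  have hpic : ∀ k, IsStronglyProgressive 𝔽 fun t ω =>
      picard (fun s => α s ω) F (fun s => g s ω) x k t := by
    intro k
    induction k with
    | zero => exact isStronglyProgressive_const 𝔽 x
    | succ k ih =>
      refine StronglyAdapted.isStronglyProgressive_of_continuous (fun t => ?_) fun ω =>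
        continuous_picard (measurable_path hα ω) (hgi ω) (k + 1)
      exact stronglyMeasurable_const.add (stronglyAdapted_setIntegral_Iic
        ((isStronglyProgressive_switching_apply hα F ih).add hgp) t)
  refine ⟨fun t ω => X ω t, ?_, hXc, ?_⟩
  · refine StronglyAdapted.isStronglyProgressive_of_continuous (fun t => ?_) hXc
    exact stronglyMeasurable_of_tendsto atTop (fun k => (hpic k).stronglyAdapted t)
      (tendsto_pi_nhds.2 fun ω => hXt ω t)
  · have hNae : ∀ᵐ ω ∂μ, ω ∉ N := measure_eq_zero_iff_ae_notMem.1 hN0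
    filter_upwards [hNae] with ω hω t
    have : ∀ s, g s ω = f s ω := fun s => Set.indicator_of_mem (by exact hω) _
    have h := hXs ω t
    simp only [this] at h
    exact h

end Solutions

/-! ### Predictable versions of feedback terms -/

section PredictableVersion

variable {D : ℕ} {Ω : Type*} [mΩ : MeasurableSpace Ω] {G : Matrix (Fin D) (Fin D) ℝ}
  {α : ℝ≥0 → Ω → Fin D} {hα : ∀ t, Measurable (α t)} {μ : Measure Ω} {i : Fin D}
  {E H : Type*} [NormedAddCommGroup E] [NormedSpace ℝ E] [NormedAddCommGroup H] [NormedSpace ℝ H]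

lemma IsMarkovChainFrom.isStronglyProgressive (hc : IsMarkovChainFrom G α hα μ i) :
    IsStronglyProgressive (augFiltration α hα μ) α :=
  isStronglyProgressive_of_rightContinuous (stronglyAdapted_augFiltration α hα μ) hc.right_cont

/-- The left-limit process of the chain is predictable and agrees with the chain for almost every
time. -/
lemma IsMarkovChainFrom.exists_predictable_version (hc : IsMarkovChainFrom G α hα μ i) :
    ∃ a : ℝ≥0 → Ω → Fin D, IsStronglyPredictable (augFiltration α hα μ) a ∧
      ∀ ω, ∀ᵐ t ∂timeMeasure, a t ω = α t ω := by
  choose l hl using hc.left_lim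
  -- At time 0 the left neighbourhood filter is trivial and the chosen limit is arbitrary, so the
  -- value there is prescribed as `α 0`.
  refine ⟨fun t ω => if t = 0 then α 0 ω else l ω t, ?_, fun ω => ?_⟩
  · refine isStronglyPredictable_of_leftLimit (stronglyAdapted_augFiltration α hα μ) (by simp)
      fun ω t ht => ?_
    simpa [ht.ne'] using hl ω t
  · have := (countable_jumps (hc.right_cont ω) fun t _ => hl ω t).measure_zero timeMeasure
    filter_upwards [measure_eq_zero_iff_ae_notMem.1 this] with t ht
    by_cases h : t = 0
    · simp [h]
    · simp only [h, if_false]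
      by_contra hne
      exact ht hne

/-- `F(α)X` has a predictable version when `X` is adapted with almost surely continuous paths. -/
lemma IsMarkovChainFrom.exists_predictable_apply [SFinite μ] [SecondCountableTopology E]
    (hc : IsMarkovChainFrom G α hα μ i)
    (F : Fin D → E →L[ℝ] H) {X : ℝ≥0 → Ω → E}
    (hX : IsStronglyProgressive (augFiltration α hα μ) X)
    (hXc : ∀ᵐ ω ∂μ, Continuous fun t => X t ω) :
    ∃ ψ : ℝ≥0 → Ω → H, IsStronglyPredictable (augFiltration α hα μ) ψ ∧
      Function.uncurry (fun t ω => F (α t ω) (X t ω)) =ᵐ[timeMeasure.prod μ]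
        Function.uncurry ψ := by
  borelize E
  obtain ⟨N, hNs, hNm, hN0⟩ := exists_measurable_superset_of_null hXc
  have hNF := measurableSet_augFiltration_of_null α hα μ hNm hN0 0
  have hY := isStronglyProgressive_indicator hX hNF.compl
  have hYc : ∀ ω, Continuous fun t => Nᶜ.indicator (X t) ω := by
    intro ω
    by_cases h : ω ∈ N
    · have : (fun t => Nᶜ.indicator (X t) ω) = fun _ => 0 := by
        funext s; exact Set.indicator_of_notMem (by simpa using h) _
      rw [this]; exact continuous_const
    · have : (fun t => Nᶜ.indicator (X t) ω) = fun s => X s ω := by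
        funext s; exact Set.indicator_of_mem (by exact h) _
      rw [this]
      by_contra hc
      exact h (hNs hc)
  have hYp : IsStronglyPredictable (augFiltration α hα μ) fun t => Nᶜ.indicator (X t) :=
    isStronglyPredictable_of_leftLimit hY.stronglyAdapted rfl fun ω t _ =>
      ((hYc ω).tendsto t).mono_left nhdsWithin_le_nhds
  obtain ⟨a, hap, hae⟩ := hc.exists_predictable_version
  refine ⟨fun t ω => F (a t ω) (Nᶜ.indicator (X t) ω), ?_, ?_⟩
  · exact @stronglyMeasurable_switching_apply D E _ _ _ (augFiltration α hα μ).predictable H _ _ _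
      (StronglyMeasurable.measurable hap) F _ hYp
  · have hms : MeasurableSet {z : ℝ≥0 × Ω | a z.1 z.2 = α z.1 z.2} :=
      measurableSet_eq_fun
        (stronglyMeasurable_uncurry_of_progressive hap.isStronglyProgressive).measurable
        (stronglyMeasurable_uncurry_of_progressive hc.isStronglyProgressive).measurable
    have h1 : ∀ᵐ z ∂μ.prod timeMeasure, a z.2 z.1 = α z.2 z.1 :=
      (Measure.ae_prod_iff_ae_ae (hms.preimage measurable_swap)).2 (ae_of_all _ hae)
    have h2 : ∀ᵐ z ∂timeMeasure.prod μ, a z.1 z.2 = α z.1 z.2 :=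
      (Measure.measurePreserving_swap (μ := timeMeasure) (ν := μ)).quasiMeasurePreserving.ae h1
    have h3 : ∀ᵐ z ∂timeMeasure.prod μ, z.2 ∉ N :=
      ae_prod_of_ae_right (measure_eq_zero_iff_ae_notMem.1 hN0)
    filter_upwards [h2, h3] with z h2 h3
    simp only [Function.uncurry, h2, Set.indicator_of_mem (show z.2 ∈ Nᶜ from h3)]

lemma memLp_switching_apply {ν : Measure (ℝ≥0 × Ω)} {p : ℝ≥0∞}
    {𝔽 : Filtration ℝ≥0 mΩ} (hα : IsStronglyProgressive 𝔽 α)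
    (F : Fin D → E →L[ℝ] H) {Y : ℝ≥0 → Ω → E} (hY : MemLp (Function.uncurry Y) p ν) :
    MemLp (Function.uncurry fun t ω => F (α t ω) (Y t ω)) p ν := by
  obtain ⟨C, -, hF⟩ := exists_opNorm_bound F
  have hm := (stronglyMeasurable_uncurry_of_progressive hα).measurable
  refine hY.of_le_mul (c := C) ?_ (ae_of_all _ fun z =>
    ((F (α z.1 z.2)).le_opNorm _).trans (mul_le_mul_of_nonneg_right (hF _) (norm_nonneg _)))
  obtain ⟨Y', hY', he⟩ := hY.1
  refine ⟨_, stronglyMeasurable_switching_apply hm F hY', ?_⟩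
  filter_upwards [he] with z hz
  simp only [Function.uncurry] at hz ⊢
  rw [hz]

end PredictableVersion

/-! ### The matrix semigroup of the chain -/

section Semigroup

variable {D : ℕ}

lemma hasDerivAt_exp_smul_mulVec (G : Matrix (Fin D) (Fin D) ℝ) (φ : Fin D → ℝ) (k : Fin D)
    (r : ℝ) : HasDerivAt (fun r : ℝ => (NormedSpace.exp (r • G) *ᵥ φ) k)
      ((NormedSpace.exp (r • G) *ᵥ (G *ᵥ φ)) k) r := by
  -- The derivative of the exponential needs some Banach algebra norm; the operator norm serves
  -- locally, and the conclusion concerns a scalar function only.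
  let : NormedRing (Matrix (Fin D) (Fin D) ℝ) := Matrix.linftyOpNormedRing
  let : NormedAlgebra ℝ (Matrix (Fin D) (Fin D) ℝ) := Matrix.linftyOpNormedAlgebra
  have h := hasDerivAt_exp_smul_const (𝕂 := ℝ) G r
  let ℓ : Matrix (Fin D) (Fin D) ℝ →ₗ[ℝ] ℝ :=
    { toFun := fun M => (M *ᵥ φ) k
      map_add' := fun M N => by simp [Matrix.add_mulVec]
      map_smul' := fun c M => by simp [Matrix.smul_mulVec] }
  have := (LinearMap.toContinuousLinearMap ℓ).hasFDerivAt.comp_hasDerivAt r h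
  rw [Matrix.mulVec_mulVec]
  exact this

lemma exp_sub_smul (G : Matrix (Fin D) (Fin D) ℝ) (s t : ℝ) :
    NormedSpace.exp ((t - s) • G) = NormedSpace.exp ((-s) • G) * NormedSpace.exp (t • G) := by
  rw [← Matrix.exp_add_of_commute]
  · congr 1
    rw [← add_smul]; congr 1; ring
  · exact (Commute.refl G).smul_left _ |>.smul_right _

lemma continuous_exp_smul_apply (G : Matrix (Fin D) (Fin D) ℝ) (j k : Fin D) :
    Continuous fun r : ℝ => NormedSpace.exp (r • G) j k := by
  have h : ∀ r : ℝ, (NormedSpace.exp (r • G) *ᵥ Pi.single k 1) j = NormedSpace.exp (r • G) j k :=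
    fun r => by simp
  simp_rw [← h]
  exact continuous_iff_continuousAt.2 fun r =>
    (hasDerivAt_exp_smul_mulVec G (Pi.single k 1) j r).continuousAt

end Semigroup

/-! ### Dynkin's formula from the Markov property -/

section Dynkin

variable {D : ℕ} {Ω : Type*} [mΩ : MeasurableSpace Ω] {G : Matrix (Fin D) (Fin D) ℝ}
  {α : ℝ≥0 → Ω → Fin D} {hα : ∀ t, Measurable (α t)} {μ : Measure Ω} [IsProbabilityMeasure μ]
  {i : Fin D}

lemma eq_sum_single_mul (φ : Fin D → ℝ) (a : Fin D) :
    φ a = ∑ j, φ j * (Pi.single j 1 : Fin D → ℝ) a := by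
  simp [Pi.single_apply]

lemma integrable_apply_mul {Ω' : Type*} [MeasurableSpace Ω'] {ν : Measure Ω'} {a : Ω' → Fin D}
    (ha : Measurable a) (φ : Fin D → ℝ) {W : Ω' → ℝ}
    (hW : Integrable W ν) : Integrable (fun ω => φ (a ω) * W ω) ν := by
  refine hW.bdd_mul (c := ∑ j, ‖φ j‖)
    ((StronglyMeasurable.of_discrete (f := φ)).comp_measurable ha).aestronglyMeasurable
    (ae_of_all _ fun ω => ?_)
  exact Finset.single_le_sum (f := fun j => ‖φ j‖) (fun _ _ => norm_nonneg _)
    (Finset.mem_univ (a ω))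

/-- Decomposes `φ` into indicators of single states, reducing statements about test functions to the
form in which the Markov property is given. -/
lemma integral_apply_mul {Ω' : Type*} [MeasurableSpace Ω'] {ν : Measure Ω'} {a : Ω' → Fin D}
    (ha : Measurable a) (φ : Fin D → ℝ) {W : Ω' → ℝ} (hW : Integrable W ν) :
    ∫ ω, φ (a ω) * W ω ∂ν = ∑ j, φ j * ∫ ω, (Pi.single j 1 : Fin D → ℝ) (a ω) * W ω ∂ν := by
  simp_rw [← integral_const_mul]
  rw [← integral_finsetSum _ fun j _ => (integrable_apply_mul ha _ hW).const_mul _]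
  congr 1
  funext ω
  rw [eq_sum_single_mul φ (a ω), Finset.sum_mul]
  simp_rw [mul_assoc]

/-- The Markov property, tested against a variable known at time `s`. -/
lemma IsMarkovChainFrom.integral_apply_mul_eq (hc : IsMarkovChainFrom G α hα μ i) {s t : ℝ≥0}
    (hst : s ≤ t) (φ : Fin D → ℝ) {W : Ω → ℝ} (hWm : StronglyMeasurable[augFiltration α hα μ s] W)
    (hW : Integrable W μ) :
    ∫ ω, φ (α t ω) * W ω ∂μ =
      ∫ ω, (NormedSpace.exp (((t : ℝ) - s) • G) *ᵥ φ) (α s ω) * W ω ∂μ := by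
  have key : ∀ j, ∫ ω, (Pi.single j 1 : Fin D → ℝ) (α t ω) * W ω ∂μ =
      ∫ ω, NormedSpace.exp (((t : ℝ) - s) • G) (α s ω) j * W ω ∂μ := by
    intro j
    have hp : (fun ω => (Pi.single j 1 : Fin D → ℝ) (α t ω)) =
        Set.indicator {ω | α t ω = j} (fun _ => (1 : ℝ)) := by
      funext ω
      by_cases h : α t ω = j
      · rw [Set.indicator_of_mem (by exact h), h]; simp
      · rw [Set.indicator_of_notMem (by exact h)]; simp [h]
    have hpi : Integrable (fun ω => (Pi.single j 1 : Fin D → ℝ) (α t ω)) μ := by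
      simpa using integrable_apply_mul (ν := μ) (hα t) (Pi.single j 1 : Fin D → ℝ)
        (integrable_const (1 : ℝ))
    have hWp : Integrable (W * fun ω => (Pi.single j 1 : Fin D → ℝ) (α t ω)) μ := by
      rw [mul_comm]
      exact integrable_apply_mul (ν := μ) (hα t) (Pi.single j 1 : Fin D → ℝ) hW
    -- `W` is known at time `s`, so it factors out of the conditional expectation, and the Markov
    -- property evaluates what remains.
    have h1 := condExp_mul_of_stronglyMeasurable_left hWm hWp hpi
    have h2 := hc.markov s t hst j
    rw [← hp] at h2
    calc ∫ ω, (Pi.single j 1 : Fin D → ℝ) (α t ω) * W ω ∂μ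
        = ∫ ω, (W * fun ω => (Pi.single j 1 : Fin D → ℝ) (α t ω)) ω ∂μ := by
          simp [mul_comm]
      _ = ∫ ω, (μ[W * fun ω => (Pi.single j 1 : Fin D → ℝ) (α t ω) |
            augFiltration α hα μ s]) ω ∂μ := (integral_condExp ((augFiltration α hα μ).le s)).symm
      _ = _ := by
          refine integral_congr_ae ?_
          filter_upwards [h1, h2] with ω h1 h2
          rw [h1, Pi.mul_apply, h2, mul_comm]
  rw [integral_apply_mul (hα t) φ hW]
  simp_rw [key, ← integral_const_mul]
  rw [← integral_finsetSum _ fun j _ => Integrable.const_mul (integrable_apply_mul (hα s)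
    (fun a => NormedSpace.exp (((t : ℝ) - s) • G) a j) hW) _]
  congr 1
  funext ω
  rw [Matrix.mulVec, dotProduct, Finset.sum_mul]
  refine Finset.sum_congr rfl fun j _ => by ring

variable {Z ζ : ℝ≥0 → Ω → ℝ} {z₀ : ℝ}

lemma ae_integrable_section {T : ℝ≥0}
    (hζi : Integrable (Function.uncurry ζ) ((timeMeasure.restrict (Set.Iic T)).prod μ)) :
    ∀ᵐ s ∂timeMeasure.restrict (Set.Iic T), Integrable (ζ s) μ := hζi.prod_right_ae

lemma integrableOn_integral_apply_mul (hα' : IsStronglyProgressive (augFiltration α hα μ) α)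
    {T : ℝ≥0}
    (hζi : Integrable (Function.uncurry ζ) ((timeMeasure.restrict (Set.Iic T)).prod μ))
    (φ : Fin D → ℝ) :
    IntegrableOn (fun s => ∫ ω, φ (α s ω) * ζ s ω ∂μ) (Set.Iic T) timeMeasure :=
  (integrable_apply_mul (stronglyMeasurable_uncurry_of_progressive hα').measurable φ
    hζi).integral_prod_left

lemma integrable_primitive {t : ℝ≥0}
    (hζi : Integrable (Function.uncurry ζ) ((timeMeasure.restrict (Set.Iic t)).prod μ))
    (hZ : ∀ᵐ ω ∂μ, Z t ω = z₀ + ∫ s in Set.Iic t, ζ s ω ∂timeMeasure) : Integrable (Z t) μ :=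
  ((integrable_const z₀).add hζi.integral_prod_right).congr (by
    filter_upwards [hZ] with ω h
    rw [h]; rfl)

lemma integrableOn_sum_mul_exp (hα' : IsStronglyProgressive (augFiltration α hα μ) α) {T : ℝ≥0}
    (hζi : Integrable (Function.uncurry ζ) ((timeMeasure.restrict (Set.Iic T)).prod μ))
    (k : Fin D) : IntegrableOn (fun s : ℝ≥0 =>
      ∑ j, (∫ ω, (Pi.single j 1 : Fin D → ℝ) (α s ω) * ζ s ω ∂μ) *
        NormedSpace.exp ((-(s : ℝ)) • G) j k) (Set.Iic T) timeMeasure := by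
  refine integrable_finsetSum _ fun j _ => ?_
  have hK : IsCompact (Set.Iic T) := by
    have : Set.Iic T = Set.Icc 0 T := by ext; simp
    rw [this]; exact isCompact_Icc
  exact IntegrableOn.mul_continuousOn (integrableOn_integral_apply_mul hα' hζi (Pi.single j 1))
    ((continuous_exp_smul_apply G j k).comp (by fun_prop : Continuous fun s : ℝ≥0 =>
      -(s : ℝ))).continuousOn hK

/-- Representation of `E[φ(α_t) Z_t]` through the semigroup of the chain. -/
lemma IsMarkovChainFrom.integral_apply_mul_primitive (hc : IsMarkovChainFrom G α hα μ i)
    (hζ : IsStronglyProgressive (augFiltration α hα μ) ζ) {t : ℝ≥0}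
    (hζi : Integrable (Function.uncurry ζ) ((timeMeasure.restrict (Set.Iic t)).prod μ))
    (hZ : ∀ᵐ ω ∂μ, Z t ω = z₀ + ∫ s in Set.Iic t, ζ s ω ∂timeMeasure) (φ : Fin D → ℝ) :
    ∫ ω, φ (α t ω) * Z t ω ∂μ = ∑ k, ((if i = k then z₀ else 0) + ∫ s in Set.Iic t,
      (∑ j, (∫ ω, (Pi.single j 1 : Fin D → ℝ) (α s ω) * ζ s ω ∂μ) *
        NormedSpace.exp ((-(s : ℝ)) • G) j k) ∂timeMeasure) *
          (NormedSpace.exp ((t : ℝ) • G) *ᵥ φ) k := by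
  have hα' := hc.isStronglyProgressive
  have hh := fun j => integrableOn_integral_apply_mul hα' hζi (Pi.single j 1)
  have hφ1 : Integrable (fun ω => φ (α t ω)) μ := by
    simpa using integrable_apply_mul (ν := μ) (hα t) φ (integrable_const (1 : ℝ))
  have h0 : ∫ ω, φ (α t ω) ∂μ = (NormedSpace.exp ((t : ℝ) • G) *ᵥ φ) i := by
    have h := hc.integral_apply_mul_eq (zero_le (a := t)) φ (W := fun _ => 1)
      stronglyMeasurable_const (integrable_const _)
    simp only [mul_one, NNReal.coe_zero, sub_zero] at h
    rw [h]
    have : ∀ᵐ ω ∂μ, (NormedSpace.exp ((t : ℝ) • G) *ᵥ φ) (α 0 ω) =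
        (NormedSpace.exp ((t : ℝ) • G) *ᵥ φ) i := by
      filter_upwards [hc.init] with ω hω
      rw [hω]
    rw [integral_congr_ae this]
    simp
  have hprod : Integrable (fun p : ℝ≥0 × Ω => φ (α t p.2) * ζ p.1 p.2)
      ((timeMeasure.restrict (Set.Iic t)).prod μ) :=
    integrable_apply_mul ((hα t).comp measurable_snd) φ hζi
  have hI : Integrable (fun ω => φ (α t ω) * ∫ s in Set.Iic t, ζ s ω ∂timeMeasure) μ :=
    integrable_apply_mul (hα t) φ hζi.integral_prod_right
  have h1 : ∫ ω, φ (α t ω) * Z t ω ∂μ = (NormedSpace.exp ((t : ℝ) • G) *ᵥ φ) i * z₀ +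
      ∫ s in Set.Iic t, (∫ ω, φ (α t ω) * ζ s ω ∂μ) ∂timeMeasure := by
    rw [integral_integral_swap hprod]
    simp_rw [integral_const_mul]
    rw [← h0, ← integral_mul_const, ← integral_add (hφ1.mul_const _) hI]
    refine integral_congr_ae ?_
    filter_upwards [hZ] with ω h
    rw [h]; ring
  -- Conditioning at time `s` replaces `φ(α_t)` by `(e^{(t-s)G}φ)(α_s)`; factoring the exponential
  -- separates the variables `s` and `t`.
  have h2 : ∫ s in Set.Iic t, (∫ ω, φ (α t ω) * ζ s ω ∂μ) ∂timeMeasure =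
      ∫ s in Set.Iic t, (∑ k, (∑ j, (∫ ω, (Pi.single j 1 : Fin D → ℝ) (α s ω) * ζ s ω ∂μ) *
        NormedSpace.exp ((-(s : ℝ)) • G) j k) *
          (NormedSpace.exp ((t : ℝ) • G) *ᵥ φ) k) ∂timeMeasure := by
    refine integral_congr_ae ?_
    filter_upwards [ae_integrable_section hζi, ae_restrict_mem measurableSet_Iic] with s hs hst
    rw [hc.integral_apply_mul_eq hst φ (hζ.stronglyAdapted s) hs, exp_sub_smul,
      ← Matrix.mulVec_mulVec, integral_apply_mul (hα s) _ hs]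
    simp_rw [Finset.sum_mul]
    rw [Finset.sum_comm]
    refine Finset.sum_congr rfl fun j _ => ?_
    rw [Matrix.mulVec, dotProduct, Finset.sum_mul]
    refine Finset.sum_congr rfl fun k _ => by ring
  have hη : ∀ k, IntegrableOn (fun s : ℝ≥0 =>
      ∑ j, (∫ ω, (Pi.single j 1 : Fin D → ℝ) (α s ω) * ζ s ω ∂μ) *
        NormedSpace.exp ((-(s : ℝ)) • G) j k) (Set.Iic t) timeMeasure := fun k =>
    integrableOn_sum_mul_exp hα' hζi k
  rw [h1, h2, integral_finsetSum _ fun k _ => (hη k).mul_const _]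
  simp_rw [integral_mul_const, add_mul]
  rw [Finset.sum_add_distrib]
  congr 1
  simp [mul_comm]

/-- Dynkin's formula for `φ(α_t) Z_t`, where `Z` is a primitive of an adapted process `ζ`. -/
lemma IsMarkovChainFrom.dynkin (hc : IsMarkovChainFrom G α hα μ i)
    (hζ : IsStronglyProgressive (augFiltration α hα μ) ζ) {T : ℝ≥0}
    (hζi : Integrable (Function.uncurry ζ) ((timeMeasure.restrict (Set.Iic T)).prod μ))
    (hZ : ∀ᵐ ω ∂μ, ∀ t, Z t ω = z₀ + ∫ s in Set.Iic t, ζ s ω ∂timeMeasure) (φ : Fin D → ℝ) :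
    ∫ ω, φ (α T ω) * Z T ω ∂μ = φ i * z₀ + ∫ s in Set.Iic T,
      (∫ ω, φ (α s ω) * ζ s ω ∂μ + ∫ ω, (G *ᵥ φ) (α s ω) * Z s ω ∂μ) ∂timeMeasure := by
  have hα' := hc.isStronglyProgressive
  set η : Fin D → ℝ≥0 → ℝ := fun k s =>
    ∑ j, (∫ ω, (Pi.single j 1 : Fin D → ℝ) (α s ω) * ζ s ω ∂μ) *
      NormedSpace.exp ((-(s : ℝ)) • G) j k with hη
  set w : (Fin D → ℝ) → Fin D → ℝ → ℝ := fun φ k r => (NormedSpace.exp (r • G) *ᵥ φ) k with hw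
  set y : Fin D → ℝ → ℝ := fun k r =>
    (if i = k then z₀ else 0) + ∫ v in (0 : ℝ)..r, η k v.toNNReal with hy
  have hηi : ∀ k, IntervalIntegrable (fun v : ℝ => η k v.toNNReal) volume 0 T := fun k =>
    (integrableOn_Iic_iff _ _).1 (integrableOn_sum_mul_exp hα' hζi k)
  have hwc : ∀ φ k, Continuous (w φ k) := fun φ k => continuous_iff_continuousAt.2 fun r =>
    (hasDerivAt_exp_smul_mulVec G φ k r).continuousAt
  have hw0 : ∀ k, w φ k 0 = φ k := fun k => by simp [hw]
  have hrep : ∀ (φ : Fin D → ℝ) (t : ℝ≥0), t ≤ T →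
      ∫ ω, φ (α t ω) * Z t ω ∂μ = ∑ k, y k t * w φ k t := fun φ t ht => by
    rw [hc.integral_apply_mul_primitive hζ (hζi.mono_measure
      (Measure.prod_mono (Measure.restrict_mono (Set.Iic_subset_Iic.2 ht) le_rfl) le_rfl))
      (hZ.mono fun ω h => h t) φ]
    simp only [hy, ← setIntegral_Iic_eq]
    rfl
  -- Each `y k` is absolutely continuous with density `η k`, and each `w φ k` is differentiable with
  -- derivative `w (G *ᵥ φ) k`.
  have hpr : ∀ k, y k T * w φ k T = (if i = k then z₀ else 0) * φ k + ∫ s in (0 : ℝ)..T,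
      (η k s.toNNReal * w φ k s + y k s * w (G *ᵥ φ) k s) := fun k =>
    primitive_mul_primitive T.coe_nonneg (hηi k) ((hwc _ _).intervalIntegrable _ _)
      (fun t _ => rfl) (fun t _ => by
        rw [intervalIntegral.integral_eq_sub_of_hasDerivAt (f := w φ k)
          (fun r _ => hasDerivAt_exp_smul_mulVec G φ k r) ((hwc _ _).intervalIntegrable _ _), hw0]
        ring)
  have hyc : ∀ k, ContinuousOn (y k) (Set.uIcc 0 (T : ℝ)) := fun k =>
    continuousOn_const.add (intervalIntegral.continuousOn_primitive_interval
      ((intervalIntegrable_iff').1 (hηi k)))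
  have hsum : ∀ k, IntervalIntegrable
      (fun s => η k s.toNNReal * w φ k s + y k s * w (G *ᵥ φ) k s) volume 0 T := fun k =>
    ((hηi k).mul_continuousOn (hwc _ _).continuousOn).add
      (((hyc k).mul (hwc _ _).continuousOn).intervalIntegrable)
  rw [hrep φ T le_rfl, Finset.sum_congr rfl fun k _ => hpr k, Finset.sum_add_distrib,
    ← intervalIntegral.integral_finsetSum fun k _ => hsum k]
  congr 1
  · simp [mul_comm]
  · have e : ∫ s in (0 : ℝ)..T, ∑ k, (η k s.toNNReal * w φ k s + y k s * w (G *ᵥ φ) k s) =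
        ∫ s in Set.Iic T, (∑ k, (η k s * w φ k s + y k s * w (G *ᵥ φ) k s)) ∂timeMeasure := by
      rw [setIntegral_Iic_eq (fun s : ℝ≥0 =>
        ∑ k, (η k s * w φ k s + y k s * w (G *ᵥ φ) k s))]
      refine intervalIntegral.integral_congr fun s hs => ?_
      rw [Set.uIcc_of_le T.coe_nonneg] at hs
      simp only [Real.coe_toNNReal _ hs.1]
    rw [e]
    refine integral_congr_ae ?_
    filter_upwards [ae_integrable_section hζi, ae_restrict_mem measurableSet_Iic] with s hs hsT
    rw [hrep (G *ᵥ φ) s hsT, Finset.sum_add_distrib, integral_apply_mul (hα s) φ hs]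
    congr 1
    -- At equal times the two exponential factors cancel, which turns `∑ η w` back into
    -- `E[φ(α_s)ζ_s]`.
    have hinv : NormedSpace.exp ((-(s : ℝ)) • G) *ᵥ (NormedSpace.exp ((s : ℝ) • G) *ᵥ φ) = φ := by
      rw [Matrix.mulVec_mulVec, ← exp_sub_smul]
      simp
    simp only [hη, hw]
    simp_rw [Finset.sum_mul]
    rw [Finset.sum_comm]
    refine Finset.sum_congr rfl fun j _ => ?_
    conv_rhs => rw [← hinv]
    rw [Matrix.mulVec, dotProduct, Finset.sum_mul]
    refine Finset.sum_congr rfl fun k _ => by ring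

end Dynkin

/-! ### Coercivity and the Lyapunov drift -/

section QuadraticForms

variable {D n : ℕ}

lemma sum_sum_mul_eq_dotProduct (M : Matrix (Fin n) (Fin n) ℝ) (u v : Fin n → ℝ) :
    ∑ k, ∑ l, M k l * (u k * v l) = u ⬝ᵥ (M *ᵥ v) := by
  simp only [dotProduct, Matrix.mulVec, Finset.mul_sum]
  exact Finset.sum_congr rfl fun k _ => Finset.sum_congr rfl fun l _ => by ring

lemma abs_dotProduct_mulVec_le (M : Matrix (Fin n) (Fin n) ℝ) (u v : Fin n → ℝ) :
    |u ⬝ᵥ (M *ᵥ v)| ≤ (∑ k, ∑ l, |M k l|) * (‖u‖ * ‖v‖) := by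
  rw [← sum_sum_mul_eq_dotProduct, Finset.sum_mul]
  refine (Finset.abs_sum_le_sum_abs _ _).trans (Finset.sum_le_sum fun k _ => ?_)
  rw [Finset.sum_mul]
  refine (Finset.abs_sum_le_sum_abs _ _).trans (Finset.sum_le_sum fun l _ => ?_)
  rw [abs_mul, abs_mul]
  have h1 := norm_le_pi_norm u k
  have h2 := norm_le_pi_norm v l
  rw [Real.norm_eq_abs] at h1 h2
  gcongr

/-- A positive definite form dominates a multiple of the squared norm. -/
lemma exists_coercive {M : Matrix (Fin n) (Fin n) ℝ} (hM : M.PosDef) :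
    ∃ c > 0, ∀ v : Fin n → ℝ, c * ‖v‖ ^ 2 ≤ v ⬝ᵥ (M *ᵥ v) := by
  have hpos : ∀ v : Fin n → ℝ, v ≠ 0 → 0 < v ⬝ᵥ (M *ᵥ v) := fun v hv => by
    simpa using hM.dotProduct_mulVec_pos hv
  -- The unit sphere is empty exactly when `n = 0`; otherwise the constant is the minimum of the
  -- form on this compact set.
  rcases (Metric.sphere (0 : Fin n → ℝ) 1).eq_empty_or_nonempty with h | h
  · refine ⟨1, one_pos, fun v => ?_⟩
    have : v = 0 := by
      by_contra hv
      have : (‖v‖⁻¹ • v) ∈ Metric.sphere (0 : Fin n → ℝ) 1 := by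
        rw [mem_sphere_zero_iff_norm, norm_smul, norm_inv, norm_norm,
          inv_mul_cancel₀ (norm_ne_zero_iff.2 hv)]
      rw [h] at this
      exact this
    simp [this]
  · have hcont : Continuous fun v : Fin n → ℝ => v ⬝ᵥ (M *ᵥ v) := by
      simp only [dotProduct, Matrix.mulVec]
      fun_prop
    obtain ⟨w, hw, hmin⟩ := (isCompact_sphere (0 : Fin n → ℝ) 1).exists_isMinOn h
      hcont.continuousOn
    have hw1 : ‖w‖ = 1 := mem_sphere_zero_iff_norm.1 hw
    refine ⟨w ⬝ᵥ (M *ᵥ w), hpos w (fun h0 => by simp [h0] at hw1), fun v => ?_⟩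
    rcases eq_or_ne v 0 with rfl | hv
    · simp
    · have hv' : (‖v‖⁻¹ • v) ∈ Metric.sphere (0 : Fin n → ℝ) 1 := by
        rw [mem_sphere_zero_iff_norm, norm_smul, norm_inv, norm_norm,
          inv_mul_cancel₀ (norm_ne_zero_iff.2 hv)]
      have h1 : w ⬝ᵥ (M *ᵥ w) ≤ (‖v‖⁻¹ • v) ⬝ᵥ (M *ᵥ (‖v‖⁻¹ • v)) := hmin hv'
      rw [Matrix.mulVec_smul, smul_dotProduct, dotProduct_smul, smul_eq_mul, smul_eq_mul,
        ← mul_assoc] at h1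
      have hvp : 0 < ‖v‖ := norm_pos_iff.2 hv
      have h2 := mul_le_mul_of_nonneg_right h1 (sq_nonneg ‖v‖)
      refine h2.trans (le_of_eq ?_)
      field_simp

lemma exists_uniform_coercive {M : Fin D → Matrix (Fin n) (Fin n) ℝ} (hM : ∀ j, (M j).PosDef) :
    ∃ c > 0, ∀ j, ∀ v : Fin n → ℝ, c * ‖v‖ ^ 2 ≤ v ⬝ᵥ (M j *ᵥ v) := by
  choose c hc h using fun j => exists_coercive (hM j)
  rcases isEmpty_or_nonempty (Fin D) with hD | hD
  · exact ⟨1, one_pos, fun j => hD.elim j⟩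
  · obtain ⟨j₀, hj₀⟩ := Finite.exists_min c
    exact ⟨c j₀, hc j₀, fun j v =>
      (mul_le_mul_of_nonneg_right (hj₀ j) (sq_nonneg _)).trans (h j v)⟩

/-- The drift of `⟨P(α)Y, Y⟩` along `Ẏ = a(α)Y + f`. -/
def lyapunovDrift (G : Matrix (Fin D) (Fin D) ℝ) (a P : Fin D → Matrix (Fin n) (Fin n) ℝ)
    (j : Fin D) (Y f : Fin n → ℝ) : ℝ :=
  ∑ k, ∑ l, (P j k l * ((a j *ᵥ Y + f) k * Y l + Y k * (a j *ᵥ Y + f) l) +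
    (G *ᵥ fun j' => P j' k l) j * (Y k * Y l))

/-- Regroups the coordinate sum that Dynkin's formula produces entry by entry into the matrix of the
stabilizer inequality plus two cross terms in `f`. -/
lemma lyapunovDrift_eq (G : Matrix (Fin D) (Fin D) ℝ) (a P : Fin D → Matrix (Fin n) (Fin n) ℝ)
    (j : Fin D) (Y f : Fin n → ℝ) :
    lyapunovDrift G a P j Y f = -(Y ⬝ᵥ (-(P j * a j + (a j)ᵀ * P j + ∑ j', G j j' • P j') *ᵥ Y))
      + f ⬝ᵥ (P j *ᵥ Y) + Y ⬝ᵥ (P j *ᵥ f) := by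
  have h1 : lyapunovDrift G a P j Y f = (a j *ᵥ Y + f) ⬝ᵥ (P j *ᵥ Y) +
      Y ⬝ᵥ (P j *ᵥ (a j *ᵥ Y + f)) + Y ⬝ᵥ ((∑ j', G j j' • P j') *ᵥ Y) := by
    simp only [← sum_sum_mul_eq_dotProduct, lyapunovDrift, ← Finset.sum_add_distrib]
    refine Finset.sum_congr rfl fun k _ => Finset.sum_congr rfl fun l _ => ?_
    have : (G *ᵥ fun j' => P j' k l) j = (∑ j', G j j' • P j') k l := by
      simp [Matrix.mulVec, dotProduct, Matrix.sum_apply]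
    rw [this]
    ring
  have h2 : (a j *ᵥ Y) ⬝ᵥ (P j *ᵥ Y) = Y ⬝ᵥ (((a j)ᵀ * P j) *ᵥ Y) := by
    rw [← Matrix.mulVec_mulVec, Matrix.dotProduct_mulVec Y, Matrix.vecMul_transpose]
  rw [h1, add_dotProduct, h2, Matrix.mulVec_add, dotProduct_add, Matrix.neg_mulVec,
    dotProduct_neg, Matrix.add_mulVec, Matrix.add_mulVec, dotProduct_add, dotProduct_add,
    Matrix.mulVec_mulVec]
  ring

lemma exists_lyapunovDrift_bound {G : Matrix (Fin D) (Fin D) ℝ}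
    {a P : Fin D → Matrix (Fin n) (Fin n) ℝ}
    (hM : ∀ j, (-(P j * a j + (a j)ᵀ * P j + ∑ j', G j j' • P j')).PosDef) :
    ∃ c > 0, ∃ C ≥ 0, ∀ j Y f, lyapunovDrift G a P j Y f ≤ -c * ‖Y‖ ^ 2 + C * ‖f‖ ^ 2 := by
  obtain ⟨c, hc, h⟩ := exists_uniform_coercive hM
  set K := ∑ j, ∑ k, ∑ l, |P j k l| with hK
  have hK0 : 0 ≤ K := by positivity
  have hKj : ∀ j, ∑ k, ∑ l, |P j k l| ≤ K := fun j =>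
    Finset.single_le_sum (f := fun j => ∑ k, ∑ l, |P j k l|) (fun _ _ => by positivity)
      (Finset.mem_univ j)
  -- Young's inequality, in the form `(c‖Y‖ - 2K‖f‖)² ≥ 0`, absorbs the cross terms `2K‖f‖‖Y‖` at
  -- the price of half the coercivity constant.
  refine ⟨c / 2, by positivity, 2 * K ^ 2 / c, by positivity, fun j Y f => ?_⟩
  rw [lyapunovDrift_eq]
  have e1 := h j Y
  have e2 := (le_abs_self _).trans (abs_dotProduct_mulVec_le (P j) f Y)
  have e3 := (le_abs_self _).trans (abs_dotProduct_mulVec_le (P j) Y f)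
  have e4 := mul_le_mul_of_nonneg_right (hKj j) (mul_nonneg (norm_nonneg f) (norm_nonneg Y))
  have e5 : 2 * K * (‖f‖ * ‖Y‖) ≤ c / 2 * ‖Y‖ ^ 2 + 2 * K ^ 2 / c * ‖f‖ ^ 2 := by
    have : 0 ≤ (c * ‖Y‖ - 2 * K * ‖f‖) ^ 2 / (2 * c) := by positivity
    have e : (c * ‖Y‖ - 2 * K * ‖f‖) ^ 2 / (2 * c) =
        c / 2 * ‖Y‖ ^ 2 + 2 * K ^ 2 / c * ‖f‖ ^ 2 - 2 * K * (‖f‖ * ‖Y‖) := by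
      field_simp; ring
    linarith
  rw [mul_comm ‖Y‖ ‖f‖] at e3
  linarith

end QuadraticForms

/-! ### Mean-square stability -/

section Stability

variable {D n : ℕ} {Ω : Type*} [mΩ : MeasurableSpace Ω] {G : Matrix (Fin D) (Fin D) ℝ}
  {α : ℝ≥0 → Ω → Fin D} {hα : ∀ t, Measurable (α t)} {μ : Measure Ω} [IsProbabilityMeasure μ]
  {i : Fin D}

/-- Multiplication by a matrix as a continuous linear map. -/
noncomputable def mulVecCLM {n m : ℕ} (M : Matrix (Fin n) (Fin m) ℝ) :
    (Fin m → ℝ) →L[ℝ] (Fin n → ℝ) :=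
  LinearMap.toContinuousLinearMap M.mulVecLin

@[simp]
lemma mulVecCLM_apply {n m : ℕ} (M : Matrix (Fin n) (Fin m) ℝ) (v : Fin m → ℝ) :
    mulVecCLM M v = M *ᵥ v := rfl

/-- Cauchy–Schwarz against the constant 1, by expanding `∫ (T g - K)² ≥ 0`; a measure of zero mass
is treated apart because one divides by `T`. -/
lemma sq_integral_le {Ω' : Type*} [MeasurableSpace Ω'] {ν : Measure Ω'} [IsFiniteMeasure ν]
    {g : Ω' → ℝ} (hg : MemLp g 2 ν) :
    (∫ ω, g ω ∂ν) ^ 2 ≤ ν.real Set.univ * ∫ ω, g ω ^ 2 ∂ν := by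
  have h1 : Integrable g ν := hg.integrable one_le_two
  have h2 : Integrable (fun ω => g ω ^ 2) ν := hg.integrable_sq
  set T := ν.real Set.univ
  set K := ∫ ω, g ω ∂ν
  have h : 0 ≤ ∫ ω, (T * g ω - K) ^ 2 ∂ν := integral_nonneg fun _ => sq_nonneg _
  have e : ∫ ω, (T * g ω - K) ^ 2 ∂ν = T * (T * (∫ ω, g ω ^ 2 ∂ν) - K ^ 2) := by
    have : ∀ ω, (T * g ω - K) ^ 2 = T ^ 2 * g ω ^ 2 - 2 * T * K * g ω + K ^ 2 := fun ω => by ring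
    simp_rw [this]
    have h3 : Integrable (fun ω => T ^ 2 * g ω ^ 2 - 2 * T * K * g ω) ν :=
      (h2.const_mul _).sub (h1.const_mul _)
    rw [integral_add h3 (integrable_const _), integral_sub (h2.const_mul _) (h1.const_mul _),
      integral_const_mul, integral_const_mul, integral_const, smul_eq_mul]
    change T ^ 2 * _ - 2 * T * K * K + T * K ^ 2 = _
    ring
  rw [e] at h
  rcases (measureReal_nonneg : 0 ≤ T).eq_or_lt with h0 | h0
  · have : ν = 0 := by
      have : ν.real Set.univ = 0 := h0.symm
      rw [measureReal_eq_zero_iff] at this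
      exact Measure.measure_univ_eq_zero.1 this
    have hK : K = 0 := by simp [K, this]
    rw [hK, show T = 0 from h0.symm]; simp
  · have := nonneg_of_mul_nonneg_right h h0
    linarith

variable {x : Fin n → ℝ} {a : Fin D → Matrix (Fin n) (Fin n) ℝ} {f X : ℝ≥0 → Ω → Fin n → ℝ}

lemma memLp_restrict_prod {E : Type*} [NormedAddCommGroup E] {f : ℝ≥0 → Ω → E}
    (hf : MemLp (Function.uncurry f) 2 (timeMeasure.prod μ)) (T : ℝ≥0) :
    MemLp (Function.uncurry f) 2 ((timeMeasure.restrict (Set.Iic T)).prod μ) :=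
  hf.mono_measure (Measure.prod_mono Measure.restrict_le_self le_rfl)

/-- Solutions of the linear state equation are square integrable on bounded time intervals. -/
lemma memLp_solution_restrict {𝔽 : Filtration ℝ≥0 mΩ} (hα' : IsStronglyProgressive 𝔽 α)
    (hfL : MemLp (Function.uncurry f) 2 (timeMeasure.prod μ)) (hX : IsStronglyProgressive 𝔽 X)
    (hXs : ∀ᵐ ω ∂μ, Continuous (fun t => X t ω) ∧ ∀ t, X t ω =
      x + ∫ s in Set.Iic t, (a (α s ω) *ᵥ X s ω + f s ω) ∂timeMeasure) (T : ℝ≥0) :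
    MemLp (Function.uncurry X) 2 ((timeMeasure.restrict (Set.Iic T)).prod μ) := by
  obtain ⟨C, hC, hF⟩ := exists_opNorm_bound fun j => mulVecCLM (a j)
  have hfT := memLp_restrict_prod hfL T
  have hmX := (stronglyMeasurable_uncurry_of_progressive hX).aestronglyMeasurable
    (μ := (timeMeasure.restrict (Set.Iic T)).prod μ)
  have hsq : Integrable (fun ω => ∫ s in Set.Iic T, ‖f s ω‖ ^ 2 ∂timeMeasure) μ :=
    ((memLp_two_iff_integrable_sq_norm hfT.1).1 hfT).integral_prod_right
  set E := Real.exp (C * T)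
  -- Square of the pathwise Grönwall bound, with `(∫‖f‖)² ≤ T ∫‖f‖²`. It does not depend on `t ≤ T`
  -- and has finite expectation.
  set B : Ω → ℝ := fun ω =>
    (2 * ‖x‖ ^ 2 + 2 * (T * ∫ s in Set.Iic T, ‖f s ω‖ ^ 2 ∂timeMeasure)) * E ^ 2
  have hB : Integrable B μ := ((integrable_const _).add ((hsq.const_mul _).const_mul _)).mul_const _
  have hbound : ∀ᵐ ω ∂μ, ∀ t ≤ T, ‖X t ω‖ ^ 2 ≤ B ω := by
    filter_upwards [hXs, ae_memLp_path hfL] with ω hω hfω t ht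
    have h1 := norm_solution_le (F := fun j => mulVecCLM (a j)) hC hF (measurable_path hα' ω)
      (integrableOn_Iic_of_memLp hfω) hω.1 hω.2 ht
    have h2 := sq_integral_le (hfω.restrict (Set.Iic T)).norm
    have hTr : (timeMeasure.restrict (Set.Iic T)).real Set.univ = T := by
      simp [Measure.real, timeMeasure_Iic]
    rw [hTr] at h2
    have hK0 : 0 ≤ ∫ s in Set.Iic T, ‖f s ω‖ ∂timeMeasure := integral_nonneg fun _ => norm_nonneg _
    set K := ∫ s in Set.Iic T, ‖f s ω‖ ∂timeMeasure
    have hE : Real.exp (C * t) ≤ E := Real.exp_le_exp.2 (by gcongr)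
    calc ‖X t ω‖ ^ 2 ≤ ((‖x‖ + K) * E) ^ 2 := by
          gcongr
          exact h1.trans (mul_le_mul_of_nonneg_left hE (by positivity))
      _ = (‖x‖ + K) ^ 2 * E ^ 2 := by ring
      _ ≤ (2 * ‖x‖ ^ 2 + 2 * K ^ 2) * E ^ 2 := by
          gcongr
          nlinarith [sq_nonneg (‖x‖ - K)]
      _ ≤ B ω := by
          refine mul_le_mul_of_nonneg_right ?_ (sq_nonneg _)
          linarith
  rw [memLp_two_iff_integrable_sq_norm hmX]
  refine (hB.comp_snd (timeMeasure.restrict (Set.Iic T))).mono' (hmX.norm.pow 2) ?_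
  have h1 : ∀ᵐ z ∂(timeMeasure.restrict (Set.Iic T)).prod μ, ∀ t ≤ T, ‖X t z.2‖ ^ 2 ≤ B z.2 :=
    Measure.quasiMeasurePreserving_snd.ae hbound
  have h2 : ∀ᵐ z ∂(timeMeasure.restrict (Set.Iic T)).prod μ, z.1 ∈ Set.Iic T :=
    Measure.quasiMeasurePreserving_fst.ae (ae_restrict_mem measurableSet_Iic)
  filter_upwards [h1, h2] with z h1 h2
  rw [Real.norm_of_nonneg (by positivity)]
  exact h1 z.1 h2

/-- Dynkin's formula with the time and space integrals combined. -/
lemma IsMarkovChainFrom.dynkin_prod {Z ζ : ℝ≥0 → Ω → ℝ} {z₀ : ℝ}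
    (hc : IsMarkovChainFrom G α hα μ i)
    (hζ : IsStronglyProgressive (augFiltration α hα μ) ζ) {T : ℝ≥0}
    (hζi : Integrable (Function.uncurry ζ) ((timeMeasure.restrict (Set.Iic T)).prod μ))
    (hZi : Integrable (Function.uncurry Z) ((timeMeasure.restrict (Set.Iic T)).prod μ))
    (hZ : ∀ᵐ ω ∂μ, ∀ t, Z t ω = z₀ + ∫ s in Set.Iic t, ζ s ω ∂timeMeasure) (φ : Fin D → ℝ) :
    ∫ ω, φ (α T ω) * Z T ω ∂μ = φ i * z₀ + ∫ z, (φ (α z.1 z.2) * ζ z.1 z.2 +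
      (G *ᵥ φ) (α z.1 z.2) * Z z.1 z.2) ∂(timeMeasure.restrict (Set.Iic T)).prod μ := by
  have hαm := (stronglyMeasurable_uncurry_of_progressive hc.isStronglyProgressive).measurable
  have h1 := integrable_apply_mul hαm φ hζi
  have h2 := integrable_apply_mul hαm (G *ᵥ φ) hZi
  rw [hc.dynkin hζ hζi hZ φ]
  congr 1
  have e := integral_prod _ (h1.add h2)
  refine Eq.trans ?_ e.symm
  refine integral_congr_ae ?_
  filter_upwards [h1.prod_right_ae, h2.prod_right_ae] with s h1 h2
  exact (integral_add h1 h2).symm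

/-- The second-order energy identity for `⟨P(α_T)X_T, X_T⟩`. -/
lemma IsMarkovChainFrom.integral_quadratic_eq (hc : IsMarkovChainFrom G α hα μ i)
    (P : Fin D → Matrix (Fin n) (Fin n) ℝ)
    (hf : IsStronglyProgressive (augFiltration α hα μ) f)
    (hfL : MemLp (Function.uncurry f) 2 (timeMeasure.prod μ))
    (hX : IsStronglyProgressive (augFiltration α hα μ) X)
    (hXs : ∀ᵐ ω ∂μ, Continuous (fun t => X t ω) ∧ ∀ t, X t ω =
      x + ∫ s in Set.Iic t, (a (α s ω) *ᵥ X s ω + f s ω) ∂timeMeasure) (T : ℝ≥0) :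
    Integrable (fun z : ℝ≥0 × Ω => lyapunovDrift G a P (α z.1 z.2) (X z.1 z.2) (f z.1 z.2))
        ((timeMeasure.restrict (Set.Iic T)).prod μ) ∧
      ∫ ω, X T ω ⬝ᵥ (P (α T ω) *ᵥ X T ω) ∂μ = x ⬝ᵥ (P i *ᵥ x) +
        ∫ z, lyapunovDrift G a P (α z.1 z.2) (X z.1 z.2) (f z.1 z.2)
          ∂(timeMeasure.restrict (Set.Iic T)).prod μ := by
  have hα' := hc.isStronglyProgressive
  have hαm := (stronglyMeasurable_uncurry_of_progressive hα').measurable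
  set g : ℝ≥0 → Ω → Fin n → ℝ := fun s ω => a (α s ω) *ᵥ X s ω + f s ω with hg
  set ζ : Fin n → Fin n → ℝ≥0 → Ω → ℝ := fun k l s ω =>
    g s ω k * X s ω l + X s ω k * g s ω l with hζ
  set Z : Fin n → Fin n → ℝ≥0 → Ω → ℝ := fun k l s ω => X s ω k * X s ω l with hZ
  have hgp : IsStronglyProgressive (augFiltration α hα μ) g :=
    (isStronglyProgressive_switching_apply hα' (fun j => mulVecCLM (a j)) hX).add hf
  have hcomp : ∀ {Y : ℝ≥0 → Ω → Fin n → ℝ}, IsStronglyProgressive (augFiltration α hα μ) Y →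
      ∀ k, IsStronglyProgressive (augFiltration α hα μ) fun t ω => Y t ω k := fun hY k t =>
    (continuous_apply k).comp_stronglyMeasurable (hY t)
  have hζp : ∀ k l, IsStronglyProgressive (augFiltration α hα μ) (ζ k l) := fun k l =>
    ((hcomp hgp k).mul (hcomp hX l)).add ((hcomp hX k).mul (hcomp hgp l))
  have hXL : ∀ T, MemLp (Function.uncurry X) 2 ((timeMeasure.restrict (Set.Iic T)).prod μ) :=
    memLp_solution_restrict hα' hfL hX hXs
  have hgL : ∀ T, MemLp (Function.uncurry g) 2 ((timeMeasure.restrict (Set.Iic T)).prod μ) :=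
    fun T => (memLp_switching_apply hα' (fun j => mulVecCLM (a j)) (hXL T)).add
      (memLp_restrict_prod hfL T)
  have hZi : ∀ k l, Integrable (Function.uncurry (Z k l))
      ((timeMeasure.restrict (Set.Iic T)).prod μ) := fun k l =>
    ((hXL T).eval k).integrable_mul ((hXL T).eval l)
  have hζi : ∀ k l, Integrable (Function.uncurry (ζ k l))
      ((timeMeasure.restrict (Set.Iic T)).prod μ) := fun k l =>
    (((hgL T).eval k).integrable_mul ((hXL T).eval l)).add
      (((hXL T).eval k).integrable_mul ((hgL T).eval l))
  -- The product rule makes each `X_k X_l` a primitive, so Dynkin's formula applies with `φ` the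
  -- entry `P_{kl}`; summing over `k` and `l` gives the identity.
  have hZs : ∀ k l, ∀ᵐ ω ∂μ, ∀ t, Z k l t ω =
      x k * x l + ∫ s in Set.Iic t, ζ k l s ω ∂timeMeasure := by
    intro k l
    filter_upwards [hXs, ae_memLp_path hfL] with ω hω hfω t
    have hgi : ∀ t, IntegrableOn (fun s => g s ω) (Set.Iic t) timeMeasure :=
      integrableOn_switching_affine (measurable_path hα' ω) (fun j => mulVecCLM (a j)) hω.1
        (integrableOn_Iic_of_memLp hfω)
    have hgk : ∀ k t, IntegrableOn (fun s => g s ω k) (Set.Iic t) timeMeasure := fun k t =>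
      Integrable.eval (hgi t) k
    have hXk : ∀ (k : Fin n) (r : ℝ), r ∈ Set.Icc 0 (t : ℝ) → X r.toNNReal ω k =
        x k + ∫ s in (0 : ℝ)..r, g s.toNNReal ω k := fun k r hr => by
      have := setIntegral_Iic_eq (fun s => g s ω k) r.toNNReal
      rw [Real.coe_toNNReal _ hr.1] at this
      rw [← this, hω.2, Pi.add_apply, eval_integral fun k => hgk k _]
    have h := primitive_mul_primitive t.coe_nonneg ((integrableOn_Iic_iff _ _).1 (hgk k t))
      ((integrableOn_Iic_iff _ _).1 (hgk l t)) (hXk k) (hXk l)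
    rw [Real.toNNReal_coe] at h
    rw [setIntegral_Iic_eq]
    exact h
  have hΦ : ∀ k l, Integrable (fun z : ℝ≥0 × Ω => P (α z.1 z.2) k l * ζ k l z.1 z.2 +
      (G *ᵥ fun j => P j k l) (α z.1 z.2) * Z k l z.1 z.2)
        ((timeMeasure.restrict (Set.Iic T)).prod μ) := fun k l =>
    (integrable_apply_mul hαm (fun j => P j k l) (hζi k l)).add
      (integrable_apply_mul hαm (G *ᵥ fun j => P j k l) (hZi k l))
  have hZT : ∀ k l, Integrable (fun ω => P (α T ω) k l * Z k l T ω) μ := fun k l =>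
    integrable_apply_mul (hα T) (fun j => P j k l)
      (integrable_primitive (hζi k l) ((hZs k l).mono fun ω h => h T))
  refine ⟨integrable_finsetSum _ fun k _ => integrable_finsetSum _ fun l _ => hΦ k l, ?_⟩
  simp only [← sum_sum_mul_eq_dotProduct, lyapunovDrift]
  rw [integral_finsetSum _ fun k _ => integrable_finsetSum _ fun l _ => hZT k l,
    integral_finsetSum _ fun k _ => integrable_finsetSum _ fun l _ => hΦ k l,
    ← Finset.sum_add_distrib]
  refine Finset.sum_congr rfl fun k _ => ?_
  rw [integral_finsetSum _ fun l _ => hZT k l, integral_finsetSum _ fun l _ => hΦ k l,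
    ← Finset.sum_add_distrib]
  exact Finset.sum_congr rfl fun l _ =>
    hc.dynkin_prod (hζp k l) (hζi k l) (hZi k l) (hZs k l) fun j => P j k l

/-- Mean-square stability: under the Lyapunov inequality the state is square integrable on the
whole half-line. -/
lemma IsMarkovChainFrom.memLp_of_lyapunov (hc : IsMarkovChainFrom G α hα μ i)
    {P : Fin D → Matrix (Fin n) (Fin n) ℝ} (hP : ∀ j, (P j).PosDef)
    (hLy : ∀ j, (-(P j * a j + (a j)ᵀ * P j + ∑ j', G j j' • P j')).PosDef)
    (hf : IsStronglyProgressive (augFiltration α hα μ) f)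
    (hfL : MemLp (Function.uncurry f) 2 (timeMeasure.prod μ))
    (hX : IsStronglyProgressive (augFiltration α hα μ) X)
    (hXs : ∀ᵐ ω ∂μ, Continuous (fun t => X t ω) ∧ ∀ t, X t ω =
      x + ∫ s in Set.Iic t, (a (α s ω) *ᵥ X s ω + f s ω) ∂timeMeasure) :
    MemLp (Function.uncurry X) 2 (timeMeasure.prod μ) := by
  obtain ⟨c, hc0, C, hC, hdrift⟩ := exists_lyapunovDrift_bound hLy
  have hmX := (stronglyMeasurable_uncurry_of_progressive hX).aestronglyMeasurable
    (μ := timeMeasure.prod μ)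
  have hf2 := (memLp_two_iff_integrable_sq_norm hfL.1).1 hfL
  have hcov : AECover (timeMeasure.prod μ) (atTop : Filter ℕ)
      fun k => Set.Iic (k : ℝ≥0) ×ˢ (Set.univ : Set Ω) := by
    refine ⟨ae_of_all _ fun z => ?_, fun k => measurableSet_Iic.prod MeasurableSet.univ⟩
    obtain ⟨K, hK⟩ := exists_nat_ge z.1
    filter_upwards [eventually_ge_atTop K] with k hk
    exact ⟨hK.trans (by exact_mod_cast hk), trivial⟩
  have hres : ∀ k : ℕ, (timeMeasure.prod μ).restrict (Set.Iic (k : ℝ≥0) ×ˢ (Set.univ : Set Ω)) =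
      (timeMeasure.restrict (Set.Iic (k : ℝ≥0))).prod μ := fun k => by
    rw [← Measure.prod_restrict, Measure.restrict_univ]
  have hX2 : ∀ k : ℕ, Integrable (fun z => ‖Function.uncurry X z‖ ^ 2)
      ((timeMeasure.restrict (Set.Iic (k : ℝ≥0))).prod μ) := fun k => by
    have h := memLp_solution_restrict hc.isStronglyProgressive hfL hX hXs (k : ℝ≥0)
    exact (memLp_two_iff_integrable_sq_norm h.1).1 h
  rw [memLp_two_iff_integrable_sq_norm hmX]
  -- The bound is uniform over the exhausting intervals `[0, k]`: it is what remains of the energy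
  -- identity once the nonnegative terminal term is dropped.
  refine hcov.integrable_of_integral_norm_bounded
    ((x ⬝ᵥ (P i *ᵥ x) + C * ∫ z, ‖Function.uncurry f z‖ ^ 2 ∂timeMeasure.prod μ) / c)
    (fun k => ?_) (Eventually.of_forall fun k => ?_)
  · rw [IntegrableOn, hres]
    exact hX2 k
  · rw [hres]
    simp only [Real.norm_eq_abs, abs_pow, abs_norm]
    obtain ⟨hΦ, heq⟩ := hc.integral_quadratic_eq P hf hfL hX hXs (k : ℝ≥0)
    have hpos : 0 ≤ ∫ ω, X k ω ⬝ᵥ (P (α k ω) *ᵥ X k ω) ∂μ := integral_nonneg fun ω => by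
      simpa using (hP (α k ω)).posSemidef.dotProduct_mulVec_nonneg (X k ω)
    have hfk : Integrable (fun z => ‖Function.uncurry f z‖ ^ 2)
        ((timeMeasure.restrict (Set.Iic (k : ℝ≥0))).prod μ) :=
      hf2.mono_measure (Measure.prod_mono Measure.restrict_le_self le_rfl)
    have hle := integral_mono hΦ (((hX2 k).const_mul (-c)).add (hfk.const_mul C))
      fun z => hdrift (α z.1 z.2) (X z.1 z.2) (f z.1 z.2)
    have hsplit := integral_add ((hX2 k).const_mul (-c)) (hfk.const_mul C)
    rw [integral_const_mul, integral_const_mul] at hsplit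
    have hle' := hle.trans_eq hsplit
    have hfm : ∫ z, ‖Function.uncurry f z‖ ^ 2 ∂(timeMeasure.restrict (Set.Iic (k : ℝ≥0))).prod μ ≤
        ∫ z, ‖Function.uncurry f z‖ ^ 2 ∂timeMeasure.prod μ :=
      integral_mono_measure (Measure.prod_mono Measure.restrict_le_self le_rfl)
        (ae_of_all _ fun _ => sq_nonneg _) hf2
    have hfm' := mul_le_mul_of_nonneg_left hfm hC
    rw [le_div_iff₀ hc0]
    linarith

end Stability

namespace LQData

/-! ### The feedback substitution -/

section Feedback

variable {D n m : ℕ} {Ω : Type*} [mΩ : MeasurableSpace Ω] {G : Matrix (Fin D) (Fin D) ℝ}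
  {α : ℝ≥0 → Ω → Fin D} {hα : ∀ t, Measurable (α t)} {μ : Measure Ω}
  {i : Fin D} {L : LQData D n m Ω} {x : Fin n → ℝ} {u v : ℝ≥0 → Ω → Fin m → ℝ}
  {X Y : ℝ≥0 → Ω → Fin n → ℝ} {Θ : Fin D → Matrix (Fin m) (Fin n) ℝ}

/-- The inhomogeneity enters only under time integrals, so it may be replaced by a progressive
version; `u` and `b` have the required measurability only up to null sets. -/
lemma isState_iff_of_ae_eq {𝔽 : Filtration ℝ≥0 mΩ} {f : ℝ≥0 → Ω → Fin n → ℝ}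
    (hf : ∀ᵐ ω ∂μ, ∀ᵐ s ∂timeMeasure, L.B (α s ω) *ᵥ u s ω + L.b s ω = f s ω) :
    L.IsState α 𝔽 μ x u X ↔ IsStronglyProgressive 𝔽 X ∧
      ∀ᵐ ω ∂μ, Continuous (fun t => X t ω) ∧ ∀ t, X t ω =
        x + ∫ s in Set.Iic t, (L.A (α s ω) *ᵥ X s ω + f s ω) ∂timeMeasure := by
  refine and_congr_right fun _ => eventually_congr ?_
  filter_upwards [hf] with ω hω
  refine and_congr_right fun _ => forall_congr' fun t => ?_
  have : ∫ s in Set.Iic t, (L.A (α s ω) *ᵥ X s ω + L.B (α s ω) *ᵥ u s ω + L.b s ω) ∂timeMeasure =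
      ∫ s in Set.Iic t, (L.A (α s ω) *ᵥ X s ω + f s ω) ∂timeMeasure := by
    refine integral_congr_ae (ae_restrict_of_ae ?_)
    filter_upwards [hω] with s hs
    rw [add_assoc, hs]
  rw [this]

lemma mem_L2P_of_ae_eq {𝔽 : Filtration ℝ≥0 mΩ} (hu : u ∈ L2P 𝔽 μ)
    (h : Function.uncurry v =ᵐ[timeMeasure.prod μ] Function.uncurry u) : v ∈ L2P 𝔽 μ :=
  ⟨hu.1.ae_eq h.symm, hu.2.imp fun _ hψ => ⟨hψ.1, h.trans hψ.2⟩⟩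

lemma add_mem_L2P {𝔽 : Filtration ℝ≥0 mΩ} (hu : u ∈ L2P 𝔽 μ) (hv : v ∈ L2P 𝔽 μ) :
    (fun t ω => u t ω + v t ω) ∈ L2P 𝔽 μ := by
  obtain ⟨huL, u', hu', hue⟩ := hu
  obtain ⟨hvL, v', hv', hve⟩ := hv
  exact ⟨huL.add hvL, fun t ω => u' t ω + v' t ω, hu'.add hv', hue.add hve⟩

lemma sub_mem_L2P {𝔽 : Filtration ℝ≥0 mΩ} (hu : u ∈ L2P 𝔽 μ) (hv : v ∈ L2P 𝔽 μ) :
    (fun t ω => u t ω - v t ω) ∈ L2P 𝔽 μ := by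
  obtain ⟨huL, u', hu', hue⟩ := hu
  obtain ⟨hvL, v', hv', hve⟩ := hv
  exact ⟨huL.sub hvL, fun t ω => u' t ω - v' t ω, hu'.sub hv', hue.sub hve⟩

lemma transpose_mulVec_dotProduct {p r : ℕ} (M : Matrix (Fin p) (Fin r) ℝ) (y : Fin p → ℝ)
    (w : Fin r → ℝ) : (Mᵀ *ᵥ y) ⬝ᵥ w = (M *ᵥ w) ⬝ᵥ y := by
  rw [dotProduct_comm, Matrix.dotProduct_mulVec, Matrix.vecMul_transpose]

/-- Completing the substitution `u = ΘX + v` in the running cost. -/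
lemma runningCost_transform (hR : ∀ j, (L.R j).PosDef) (t : ℝ≥0) (ω : Ω) (y : Fin n → ℝ)
    (w : Fin m → ℝ) :
    (Matrix.fromBlocks ((L.transform α Θ).Q (α t ω)) ((L.transform α Θ).S (α t ω))ᵀ
          ((L.transform α Θ).S (α t ω)) ((L.transform α Θ).R (α t ω)) *ᵥ Sum.elim y w) ⬝ᵥ
        Sum.elim y w + 2 * (Sum.elim ((L.transform α Θ).q t ω) ((L.transform α Θ).ρ t ω) ⬝ᵥ
          Sum.elim y w) =
      (Matrix.fromBlocks (L.Q (α t ω)) (L.S (α t ω))ᵀ (L.S (α t ω)) (L.R (α t ω)) *ᵥ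
          Sum.elim y (Θ (α t ω) *ᵥ y + w)) ⬝ᵥ Sum.elim y (Θ (α t ω) *ᵥ y + w) +
        2 * (Sum.elim (L.q t ω) (L.ρ t ω) ⬝ᵥ Sum.elim y (Θ (α t ω) *ᵥ y + w)) := by
  have hRs : (L.R (α t ω))ᵀ = L.R (α t ω) := by
    have := (hR (α t ω)).isHermitian
    rwa [Matrix.IsHermitian, Matrix.conjTranspose_eq_transpose_of_trivial] at this
  -- Symmetry of `R` merges the two mixed terms, which produces the `RΘ` in `S + RΘ`.
  have hRd : (L.R (α t ω) *ᵥ w) ⬝ᵥ (Θ (α t ω) *ᵥ y) =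
      (L.R (α t ω) *ᵥ (Θ (α t ω) *ᵥ y)) ⬝ᵥ w := by
    rw [← transpose_mulVec_dotProduct, hRs]
  simp only [transform, Matrix.fromBlocks_mulVec, sumElim_dotProduct_sumElim,
    Sum.elim_comp_inl, Sum.elim_comp_inr, Matrix.add_mulVec, Matrix.mulVec_add,
    add_dotProduct, dotProduct_add, transpose_mulVec_dotProduct, ← Matrix.mulVec_mulVec, hRd]
  rw [dotProduct_comm (L.S (α t ω) *ᵥ y) (Θ (α t ω) *ᵥ y),
    dotProduct_comm (L.ρ t ω) (Θ (α t ω) *ᵥ y),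
    dotProduct_comm (Θ (α t ω) *ᵥ y) (L.R (α t ω) *ᵥ Θ (α t ω) *ᵥ y)]
  ring

variable [IsProbabilityMeasure μ]

/-- The inhomogeneous term `B(α)u + b` of the state equation has a progressive version. -/
lemma exists_progressive_inhomogeneity (hc : IsMarkovChainFrom G α hα μ i)
    (hb : L.b ∈ L2F (augFiltration α hα μ) μ) (hu : u ∈ L2P (augFiltration α hα μ) μ) :
    ∃ f : ℝ≥0 → Ω → Fin n → ℝ, IsStronglyProgressive (augFiltration α hα μ) f ∧
      MemLp (Function.uncurry f) 2 (timeMeasure.prod μ) ∧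
      ∀ᵐ ω ∂μ, ∀ᵐ s ∂timeMeasure, L.B (α s ω) *ᵥ u s ω + L.b s ω = f s ω := by
  obtain ⟨huL, u', hu', hue⟩ := hu
  obtain ⟨hbL, b', hb', hbe⟩ := hb
  have hα' := hc.isStronglyProgressive
  refine ⟨fun s ω => mulVecCLM (L.B (α s ω)) (u' s ω) + b' s ω,
    (isStronglyProgressive_switching_apply hα' (fun j => mulVecCLM (L.B j))
      hu'.isStronglyProgressive).add hb',
    (memLp_switching_apply hα' (fun j => mulVecCLM (L.B j)) (huL.ae_eq hue)).add
      (hbL.ae_eq hbe), ?_⟩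
  filter_upwards [ae_ae_of_ae_prod_right hue, ae_ae_of_ae_prod_right hbe] with ω h1 h2
  filter_upwards [h1, h2] with s h1 h2
  simp only [Function.uncurry] at h1 h2
  rw [h1, h2, mulVecCLM_apply]

/-- `state` is chosen by `epsilon`, so it solves the equation as soon as some solution exists; the
pathwise construction provides one. -/
lemma isState_state (hc : IsMarkovChainFrom G α hα μ i)
    (hb : L.b ∈ L2F (augFiltration α hα μ) μ) (hu : u ∈ L2P (augFiltration α hα μ) μ)
    (x : Fin n → ℝ) : L.IsState α (augFiltration α hα μ) μ x u
      (L.state α (augFiltration α hα μ) μ x u) := by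
  obtain ⟨f, hf, hfL, hfe⟩ := exists_progressive_inhomogeneity hc hb hu
  obtain ⟨X, hX, hXc, hXs⟩ := exists_progressive_solution (μ := μ)
    (fun N hN h0 => measurableSet_augFiltration_of_null α hα μ hN h0 0) hc.isStronglyProgressive
    (fun j => mulVecCLM (L.A j)) hf
    ((ae_memLp_path hfL).mono fun ω h => integrableOn_Iic_of_memLp h) x
  exact Classical.epsilon_spec (p := L.IsState α (augFiltration α hα μ) μ x u)
    ⟨X, (isState_iff_of_ae_eq hfe).2 ⟨hX, hXs.mono fun ω h => ⟨hXc ω, h⟩⟩⟩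

lemma IsState.unique (hc : IsMarkovChainFrom G α hα μ i)
    (hb : L.b ∈ L2F (augFiltration α hα μ) μ) (hu : u ∈ L2P (augFiltration α hα μ) μ)
    (hX : L.IsState α (augFiltration α hα μ) μ x u X)
    (hY : L.IsState α (augFiltration α hα μ) μ x u Y) : ∀ᵐ ω ∂μ, ∀ t, X t ω = Y t ω := by
  obtain ⟨f, hf, hfL, hfe⟩ := exists_progressive_inhomogeneity hc hb hu
  filter_upwards [((isState_iff_of_ae_eq hfe).1 hX).2, ((isState_iff_of_ae_eq hfe).1 hY).2,
    ae_memLp_path hfL] with ω h1 h2 h3 t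
  exact congrFun (solution_unique (F := fun j => mulVecCLM (L.A j))
    (measurable_path hc.isStronglyProgressive ω) (integrableOn_Iic_of_memLp h3) h1.1 h2.1 h1.2
    h2.2) t

/-- Feeding back `u = Θ(α)X + v` turns the original state equation into the transformed one. -/
lemma isState_transform_iff {𝔽 : Filtration ℝ≥0 mΩ}
    (huv : Function.uncurry u =ᵐ[timeMeasure.prod μ]
      Function.uncurry fun t ω => Θ (α t ω) *ᵥ X t ω + v t ω) :
    (L.transform α Θ).IsState α 𝔽 μ x v X ↔ L.IsState α 𝔽 μ x u X := by
  refine and_congr_right fun _ => eventually_congr ?_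
  filter_upwards [ae_ae_of_ae_prod_right huv] with ω hω
  refine and_congr_right fun _ => forall_congr' fun t => ?_
  have : ∫ s in Set.Iic t, ((L.transform α Θ).A (α s ω) *ᵥ X s ω +
        (L.transform α Θ).B (α s ω) *ᵥ v s ω + (L.transform α Θ).b s ω) ∂timeMeasure =
      ∫ s in Set.Iic t, (L.A (α s ω) *ᵥ X s ω + L.B (α s ω) *ᵥ u s ω + L.b s ω) ∂timeMeasure := by
    refine integral_congr_ae (ae_restrict_of_ae ?_)
    filter_upwards [hω] with s hs
    simp only [Function.uncurry] at hs
    rw [hs]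
    simp only [transform, Matrix.add_mulVec, Matrix.mulVec_add, Matrix.mulVec_mulVec]
    abel
  rw [this]

lemma IsState.gain_mem_L2P (hc : IsMarkovChainFrom G α hα μ i)
    (hX : L.IsState α (augFiltration α hα μ) μ x u X)
    (hXL : MemLp (Function.uncurry X) 2 (timeMeasure.prod μ)) :
    (fun t ω => Θ (α t ω) *ᵥ X t ω) ∈ L2P (augFiltration α hα μ) μ :=
  ⟨memLp_switching_apply hc.isStronglyProgressive (fun j => mulVecCLM (Θ j)) hXL,
    hc.exists_predictable_apply (fun j => mulVecCLM (Θ j)) hX.1 (hX.2.mono fun _ h => h.1)⟩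

/-- For a stabilizer `Θ`, the transformed state is square integrable. -/
lemma memLp_state_transform (hc : IsMarkovChainFrom G α hα μ i) (hΘ : Θ ∈ L.stabilizers G)
    (hb : L.b ∈ L2F (augFiltration α hα μ) μ) (hv : v ∈ L2P (augFiltration α hα μ) μ)
    (hX : (L.transform α Θ).IsState α (augFiltration α hα μ) μ x v X) :
    MemLp (Function.uncurry X) 2 (timeMeasure.prod μ) := by
  obtain ⟨P, hP, hLy⟩ := hΘ
  obtain ⟨f, hf, hfL, hfe⟩ :=
    exists_progressive_inhomogeneity (L := L.transform α Θ) hc hb hv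
  exact hc.memLp_of_lyapunov hP hLy hf hfL hX.1 ((isState_iff_of_ae_eq hfe).1 hX).2

/-- A control that agrees almost everywhere with a feedback control is predictable, drives the
state to the transformed state, and has the transformed cost. -/
lemma feedback_spec (hc : IsMarkovChainFrom G α hα μ i) (hR : ∀ j, (L.R j).PosDef)
    (hΘ : Θ ∈ L.stabilizers G) (hb : L.b ∈ L2F (augFiltration α hα μ) μ)
    (hv : v ∈ L2P (augFiltration α hα μ) μ)
    (huv : Function.uncurry u =ᵐ[timeMeasure.prod μ]
      Function.uncurry (L.feedback α (augFiltration α hα μ) μ Θ x v)) :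
    u ∈ L.admissible α (augFiltration α hα μ) μ x ∧
      (L.transform α Θ).cost α (augFiltration α hα μ) μ x v =
        L.cost α (augFiltration α hα μ) μ x u := by
  have hXΘ := isState_state (L := L.transform α Θ) hc hb hv x
  have hXL := memLp_state_transform hc hΘ hb hv hXΘ
  have hu : u ∈ L2P (augFiltration α hα μ) μ :=
    mem_L2P_of_ae_eq (add_mem_L2P (hXΘ.gain_mem_L2P hc hXL) hv) huv
  -- Both the original state under `u` and the transformed state under `v` solve the original
  -- equation driven by `u`.
  have heq := IsState.unique hc hb hu (isState_state hc hb hu x)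
    ((isState_transform_iff huv).1 hXΘ)
  have heq' : Function.uncurry (L.state α (augFiltration α hα μ) μ x u) =ᵐ[timeMeasure.prod μ]
      Function.uncurry ((L.transform α Θ).state α (augFiltration α hα μ) μ x v) := by
    filter_upwards [ae_prod_of_ae_right heq] with z hz
    exact hz z.1
  refine ⟨⟨hu, hXL.ae_eq heq'.symm, _, hXΘ.1, heq'⟩, ?_⟩
  -- The integrands agree almost everywhere, so the costs agree without any discussion of their
  -- integrability.
  refine integral_congr_ae ?_
  filter_upwards [heq, ae_ae_of_ae_prod_right huv] with ω h1 h2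
  refine integral_congr_ae ?_
  filter_upwards [h2] with t h2
  rw [h1 t, show u t ω = _ from h2, runningCost_transform hR]
  rfl

/-- Every admissible control is a feedback control. -/
lemma exists_feedback_of_admissible (hc : IsMarkovChainFrom G α hα μ i)
    (hb : L.b ∈ L2F (augFiltration α hα μ) μ)
    (Θ : Fin D → Matrix (Fin m) (Fin n) ℝ)
    (hu : u ∈ L.admissible α (augFiltration α hα μ) μ x) :
    ∃ v ∈ L2P (augFiltration α hα μ) μ, Function.uncurry u =ᵐ[timeMeasure.prod μ]
      Function.uncurry (L.feedback α (augFiltration α hα μ) μ Θ x v) := by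
  obtain ⟨huP, hXF⟩ := hu
  have hX := isState_state hc hb huP x
  set X := L.state α (augFiltration α hα μ) μ x u
  -- The only possible preimage of `u` is `u - Θ(α)X`; uniqueness then shows that `X` is also the
  -- transformed state under it.
  have hv := sub_mem_L2P huP (hX.gain_mem_L2P (Θ := Θ) hc hXF.1)
  refine ⟨_, hv, ?_⟩
  have hXv : (L.transform α Θ).IsState α (augFiltration α hα μ) μ x
      (fun t ω => u t ω - Θ (α t ω) *ᵥ X t ω) X :=
    (isState_transform_iff (ae_of_all _ fun z => by simp [Function.uncurry])).2 hX
  have heq := IsState.unique (L := L.transform α Θ) hc hb hv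
    (isState_state (L := L.transform α Θ) hc hb hv x) hXv
  filter_upwards [ae_prod_of_ae_right heq] with z hz
  simp only [Function.uncurry, feedback]
  rw [hz z.1]
  simp

end Feedback

end LQData

end MarkovLQ

theorem mainTheorem8 {D n m : ℕ} {Ω : Type*} [mΩ : MeasurableSpace Ω]
    -- the Markov chain, with `P i` the law under which it starts at `i`
    (G : Matrix (Fin D) (Fin D) ℝ) (hG : MarkovLQ.IsIrreducibleGenerator G)
    (α : ℝ≥0 → Ω → Fin D) (hα : ∀ t, Measurable (α t))
    (P : Fin D → Measure Ω) [∀ i, IsProbabilityMeasure (P i)]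
    (hchain : ∀ i, MarkovLQ.IsMarkovChainFrom G α hα (P i) i)
    -- the coefficients
    (L : MarkovLQ.LQData D n m Ω) (hL : L.WeightsOK)
    (hb : ∀ i, L.b ∈ MarkovLQ.L2F (MarkovLQ.augFiltration α hα (P i)) (P i))
    (hq : ∀ i, L.q ∈ MarkovLQ.L2F (MarkovLQ.augFiltration α hα (P i)) (P i))
    (hρ : ∀ i, L.ρ ∈ MarkovLQ.L2F (MarkovLQ.augFiltration α hα (P i)) (P i))
    -- stabilizability
    (hH1 : (L.stabilizers G).Nonempty)
    -- the pair
    (Θ : Fin D → Matrix (Fin m) (Fin n) ℝ) (hΘ : Θ ∈ L.stabilizers G)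
    (ν : ℝ≥0 → Ω → Fin m → ℝ)
    (hν : ∀ i, ν ∈ MarkovLQ.L2P (MarkovLQ.augFiltration α hα (P i)) (P i)) :
    -- the transformed cost is the cost of the feedback control
    (∀ (x : Fin n → ℝ) (i : Fin D),
      ∀ v ∈ MarkovLQ.L2P (MarkovLQ.augFiltration α hα (P i)) (P i),
        (L.transform α Θ).cost α (MarkovLQ.augFiltration α hα (P i)) (P i) x v =
          L.cost α (MarkovLQ.augFiltration α hα (P i)) (P i) x
            (L.feedback α (MarkovLQ.augFiltration α hα (P i)) (P i) Θ x v)) ∧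
    -- the admissible controls are exactly the feedback controls (up to `dt ⊗ dP i`-null sets)
    (∀ (x : Fin n → ℝ) (i : Fin D),
      L.admissible α (MarkovLQ.augFiltration α hα (P i)) (P i) x =
        {u | ∃ v ∈ MarkovLQ.L2P (MarkovLQ.augFiltration α hα (P i)) (P i),
          Function.uncurry u =ᵐ[MarkovLQ.timeMeasure.prod (P i)] Function.uncurry
            (L.feedback α (MarkovLQ.augFiltration α hα (P i)) (P i) Θ x v)}) ∧
    -- the characterization
    (L.IsClosedLoopOptimal G α hα P Θ ν ↔
      ∀ (x : Fin n → ℝ) (i : Fin D), L.IsOpenLoopOptimalTransformed α hα P Θ x i ν) := by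
  have hfb := fun (x : Fin n → ℝ) (i : Fin D) v
      (hv : v ∈ MarkovLQ.L2P (MarkovLQ.augFiltration α hα (P i)) (P i)) u =>
    MarkovLQ.LQData.feedback_spec (x := x) (u := u) (hchain i) hL.R_pos hΘ (hb i) hv
  have hcost := fun x i v hv => (hfb x i v hv _ (ae_eq_refl _)).2
  refine ⟨hcost, fun x i => ?_, ⟨fun h x i => ⟨hν i, fun v hv => ?_⟩, fun h => ⟨hΘ, hν, ?_⟩⟩⟩
  · ext u
    exact ⟨MarkovLQ.LQData.exists_feedback_of_admissible (hchain i) (hb i) Θ,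
      fun ⟨v, hv, huv⟩ => (hfb x i v hv u huv).1⟩
  · change MarkovLQ.LQData.cost _ _ _ _ _ _ ≤ MarkovLQ.LQData.cost _ _ _ _ _ _
    rw [hcost x i ν (hν i), hcost x i v hv]
    exact h.2.2 x i _ (hfb x i v hv _ (ae_eq_refl _)).1
  · intro x i u hu
    obtain ⟨v, hv, huv⟩ :=
      MarkovLQ.LQData.exists_feedback_of_admissible (hchain i) (hb i) Θ hu
    -- The competitor `u` agrees with the feedback of `v` only almost everywhere, so its cost is
    -- transferred by `feedback_spec` for a general version.
    rw [← hcost x i ν (hν i), ← (hfb x i v hv u huv).2]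
    exact (h x i).2 hv
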